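/- Conventions. A complex space is a (not necessarily reduced, not necessarily compact) Hausdorff locally ringed space over $\mathbb C$ that is locally isomorphic to model spaces $(\{f_1=\dots=f_k=0\},\mathcal O_D/(f_1,\dots,f_k))$ with $D\subseteq\mathbb C^m$ open and $f_1,\dots,f_k$ holomorphic on $D$. For a holomorphic vector bundle $E$ on a complex space $X$, $\mathbb P E$ denotes the bundle over $X$ whose points are the pairs $(x,V)$ with $x\in X$ and $V=v^\perp$ a hyperplane of the fibre $E_x$ (where $0\ne v\in E_x^*$), so that $\mathbb P E$ is the quotient by $\mathbb C^*$ of $E^*$ minus its zero section; global sections of $\mathcal O_{\mathbb P E}(r)$ are the holomorphic functions on $E^*$ minus its zero section that are homogeneous of degree $r$ on the fibres. The line bundle $\mathcal O_{\mathbb P E}(r)$ is generated by global sections if for every $x \in X$ and every non-zero $v\in E_x^*$ there is a global section of $\mathcal O_{\mathbb P E}(r)$ that does not vanish at $(x,v)$. Lemma. For every integer $r>0$ and every integer $e\ge 0$ there is a positive integer $n$, depending only on $r$ and $e$, with the following property. Let $X$ be a complex space, and let $E$ and $F$ be holomorphic vector bundles on $X$, where $E$ has rank $e$. If $\mathcal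 O_{\mathbb P E}(r)$ and $\mathcal O_{\mathbb P F}(r)$ are generated by global sections, then $\mathcal O_{\mathbb P(E\otimes F)}(nr)$ is generated by global sections. -/

import Mathlib

open Topology TopologicalSpace CategoryTheory AlgebraicGeometry Opposite

universe u

noncomputable section

namespace CplxGeom

/-! ## Germs of holomorphic functions -/

/-- The ring of germs at `z` of holomorphic functions of a complex variable in `V`
(for `V = ℂⁿ` this is the local ring of convergent power series at `z`). -/
def HolGerm {V : Type} [NormedAddCommGroup V] [NormedSpace ℂ V] (z : V) :
    Subring (Filter.Germ (𝓝 z) ℂ) where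
  carrier := {g | ∃ F : V → ℂ, AnalyticAt ℂ F z ∧ (F : Filter.Germ (𝓝 z) ℂ) = g}
  mul_mem' := by
    rintro _ _ ⟨F, hF, rfl⟩ ⟨G, hG, rfl⟩
    exact ⟨F * G, hF.mul hG, rfl⟩
  one_mem' := ⟨fun _ => 1, analyticAt_const, rfl⟩
  add_mem' := by
    rintro _ _ ⟨F, hF, rfl⟩ ⟨G, hG, rfl⟩
    exact ⟨F + G, hF.add hG, rfl⟩
  zero_mem' := ⟨fun _ => 0, analyticAt_const, rfl⟩
  neg_mem' := by
    rintro _ ⟨F, hF, rfl⟩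
    exact ⟨-F, hF.neg, rfl⟩

/-- The germ at `z` of a function that is holomorphic near `z`. -/
def HolGerm.mk {V : Type} [NormedAddCommGroup V] [NormedSpace ℂ V] {z : V}
    (F : V → ℂ) (hF : AnalyticAt ℂ F z) : HolGerm z :=
  ⟨(F : Filter.Germ (𝓝 z) ℂ), F, hF, rfl⟩

/-! ## Complex spaces -/

/-- A local model of a locally ringed space `X` over `ℂ` (the `ℂ`-algebra structure being given by
`const`): an isomorphism of ringed spaces over `ℂ` between an open subspace `U` of `X` and the
model space `(A, 𝒪_D / (f₁, …, f_k))`, where `D ⊆ ℂⁿ` is open, `f₁, …, f_k` are holomorphic on `D`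
and `A = {f₁ = … = f_k = 0}`.

The isomorphism consists of a homeomorphism `φ` from `U` to `A` and of an isomorphism of sheaves of
`ℂ`-algebras from `φ⁻¹ (𝒪_D / (f₁, …, f_k))` to `𝒪_U`. The latter is given on stalks, by
surjections `pull x` from the ring of holomorphic germs at `φ x` to the stalk of `X` at `x` with
kernel `(f₁, …, f_k)`, which take local sections to local sections. -/
structure LocalModel (X : LocallyRingedSpace.{u}) (const : ℂ →+* X.presheaf.obj (op ⊤)) where
  U : Opens X.toTopCat
  n : ℕ
  k : ℕ
  D : Opens (Fin n → ℂ)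
  f : Fin k → (Fin n → ℂ) → ℂ
  analytic_f : ∀ j, AnalyticOnNhd ℂ (f j) D
  φ : U → (Fin n → ℂ)
  isEmbedding_φ : IsEmbedding φ
  range_φ : Set.range φ = {z | z ∈ D ∧ ∀ j, f j z = 0}
  pull : ∀ x : U, HolGerm (φ x) →+* X.presheaf.stalk x.1
  pull_const : ∀ (x : U) (a : ℂ), pull x (HolGerm.mk (fun _ => a) analyticAt_const) =
    X.presheaf.germ ⊤ x.1 trivial (const a)
  surjective_pull : ∀ x : U, Function.Surjective (pull x)
  ker_pull : ∀ x : U, RingHom.ker (pull x) = Ideal.span (Set.range fun j =>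
    HolGerm.mk (f j) (analytic_f j (φ x) (range_φ.subset (Set.mem_range_self x)).1))
  pull_section : ∀ (x : U) (F : (Fin n → ℂ) → ℂ), AnalyticAt ℂ F (φ x) →
    ∃ (W : Opens X.toTopCat) (t : X.presheaf.obj (op W)), x.1 ∈ W ∧
      ∀ (y : U) (hy : y.1 ∈ W), ∃ hF : AnalyticAt ℂ F (φ y),
        X.presheaf.germ W y.1 hy t = pull y (HolGerm.mk F hF)

/-- A complex space (not necessarily reduced): a Hausdorff locally ringed space over `ℂ` which is
locally isomorphic to model spaces. -/
structure ComplexSpace where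
  toLRS : LocallyRingedSpace.{u}
  const : ℂ →+* toLRS.presheaf.obj (op ⊤)
  t2 : T2Space toLRS.toTopCat
  exists_model : ∀ x : toLRS.toTopCat, ∃ c : LocalModel toLRS const, x ∈ c.U

namespace ComplexSpace

variable (X : ComplexSpace.{u})

/-- The underlying topological space. -/
abbrev Pt : TopCat.{u} := X.toLRS.toTopCat

/-- The local ring `𝒪_{X,x}`. -/
abbrev Stalk (x : X.Pt) : Type u := X.toLRS.presheaf.stalk x

/-- The ring `𝒪_X(U)`. -/
abbrev Sec (U : Opens X.Pt) : Type u := X.toLRS.presheaf.obj (op U)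

variable {X} in
theorem mem_inf {U V : Opens X.Pt} {x : X.Pt} (hU : x ∈ U) (hV : x ∈ V) : x ∈ U ⊓ V :=
  ⟨hU, hV⟩

/-- The germ at `x ∈ U` of a section over `U`. -/
def germ (U : Opens X.Pt) (x : X.Pt) (hx : x ∈ U) : X.Sec U →+* X.Stalk x :=
  (X.toLRS.presheaf.germ U x hx).hom

/-- Restriction of sections. -/
def res {U V : Opens X.Pt} (h : U ≤ V) : X.Sec V →+* X.Sec U :=
  (X.toLRS.presheaf.map (homOfLE h).op).hom

theorem germ_res {U V : Opens X.Pt} (h : U ≤ V) (x : X.Pt) (hx : x ∈ U) (s : X.Sec V) :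
    X.germ U x hx (X.res h s) = X.germ V x (h hx) s :=
  TopCat.Presheaf.germ_res_apply X.toLRS.presheaf (homOfLE h) x hx s

/-- The germ at `x` of the constant function `a`. -/
def constGerm (x : X.Pt) (a : ℂ) : X.Stalk x :=
  X.germ ⊤ x trivial (X.const a)

/-- The local models, i.e. the local embeddings of `X` into complex number spaces. -/
abbrev Model := LocalModel X.toLRS X.const

end ComplexSpace

/-! ## Vector bundles -/

/-- A holomorphic vector bundle `E` on `X`, given by a trivializing open cover `U i` and a
holomorphic cocycle `g i j`. Over `U i` sections of `E` are column vectors `s i` indexed by the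
finite set `J i`, and `s i = g i j * s j` on `U i ∩ U j`. (The rank is locally constant.) -/
structure HolBundle (X : ComplexSpace.{u}) where
  ι : Type u
  U : ι → Opens X.Pt
  cover : ∀ x : X.Pt, ∃ i, x ∈ U i
  J : ι → Type
  fintypeJ : ∀ i, Fintype (J i)
  decEqJ : ∀ i, DecidableEq (J i)
  g : ∀ i j, Matrix (J i) (J j) (X.Sec (U i ⊓ U j))
  g_self : ∀ (i : ι) (x : X.Pt) (hx : x ∈ U i),
    (g i i).map (X.germ (U i ⊓ U i) x (ComplexSpace.mem_inf hx hx)) = 1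
  g_mul : ∀ (i j k : ι) (x : X.Pt) (hi : x ∈ U i) (hj : x ∈ U j) (hk : x ∈ U k),
    (g i j).map (X.germ _ x (ComplexSpace.mem_inf hi hj)) * (g j k).map (X.germ _ x (ComplexSpace.mem_inf hj hk)) =
      (g i k).map (X.germ _ x (ComplexSpace.mem_inf hi hk))

attribute [instance] HolBundle.fintypeJ HolBundle.decEqJ

namespace HolBundle

variable {X : ComplexSpace.{u}}

/-- `E` has (constant) rank `e`. -/
def HasRank (E : HolBundle X) (e : ℕ) : Prop :=
  ∀ (i : E.ι) (x : X.Pt), x ∈ E.U i → Fintype.card (E.J i) = e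

theorem inf_le_left_left (A B C D : Opens X.Pt) : (A ⊓ B) ⊓ (C ⊓ D) ≤ A ⊓ C :=
  inf_le_inf inf_le_left inf_le_left

theorem inf_le_right_right (A B C D : Opens X.Pt) : (A ⊓ B) ⊓ (C ⊓ D) ≤ B ⊓ D :=
  inf_le_inf inf_le_right inf_le_right

/-- The transition matrices of `E ⊗ F`: Kronecker products over the common refinement. -/
def tensorG (E F : HolBundle X) (p q : E.ι × F.ι) :
    Matrix (E.J p.1 × F.J p.2) (E.J q.1 × F.J q.2)
      (X.Sec ((E.U p.1 ⊓ F.U p.2) ⊓ (E.U q.1 ⊓ F.U q.2))) :=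
  Matrix.kroneckerMap (fun a b => a * b)
    ((E.g p.1 q.1).map (X.res (inf_le_left_left _ _ _ _)))
    ((F.g p.2 q.2).map (X.res (inf_le_right_right _ _ _ _)))

theorem tensorG_germ (E F : HolBundle X) (p q : E.ι × F.ι) (x : X.Pt)
    (hx : x ∈ (E.U p.1 ⊓ F.U p.2) ⊓ (E.U q.1 ⊓ F.U q.2)) :
    (tensorG E F p q).map (X.germ _ x hx) =
      Matrix.kroneckerMap (fun a b => a * b)
        ((E.g p.1 q.1).map (X.germ _ x (ComplexSpace.mem_inf hx.1.1 hx.2.1)))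
        ((F.g p.2 q.2).map (X.germ _ x (ComplexSpace.mem_inf hx.1.2 hx.2.2))) := by
  ext a b
  simp [tensorG, Matrix.kroneckerMap_apply, ComplexSpace.germ_res]

/-- The tensor product `E ⊗ F`. -/
def tensor (E F : HolBundle X) : HolBundle X where
  ι := E.ι × F.ι
  U p := E.U p.1 ⊓ F.U p.2
  cover x := by
    obtain ⟨i, hi⟩ := E.cover x
    obtain ⟨k, hk⟩ := F.cover x
    exact ⟨(i, k), hi, hk⟩
  J p := E.J p.1 × F.J p.2
  fintypeJ p := inferInstance
  decEqJ p := inferInstance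
  g := tensorG E F
  g_self p x hx := by
    rw [tensorG_germ, E.g_self p.1 x hx.1, F.g_self p.2 x hx.2]
    exact Matrix.one_kronecker_one
  g_mul p q s x hp hq hs := by
    rw [tensorG_germ, tensorG_germ, tensorG_germ, ← E.g_mul p.1 q.1 s.1 x hp.1 hq.1 hs.1,
      ← F.g_mul p.2 q.2 s.2 x hp.2 hq.2 hs.2]
    exact (Matrix.mul_kronecker_mul _ _ _ _).symm

end HolBundle

/-! ## The projective bundle and the line bundles `𝒪(r)` on it

A point of `ℙ(E)` is a pair `(x, V)` with `V` a hyperplane of the fibre `E_x`. Equivalently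
`V = v^⊥` for a non-zero `v ∈ E_x^*`, determined up to a scalar, so that
`ℙ(E) = (E^* minus the zero section) / ℂ^*`. The fibre of `𝒪(r)` at `(x, V)` is the `r`-th power of
`E_x / V`, the dual of the line `ℂ v`; hence sections of `𝒪(r)` are holomorphic functions
`s(x, v) = ⟨s(x, V), v^r⟩` on `E^*` minus its zero section which are homogeneous of degree `r` in
`v`. As `X` need not be reduced, "holomorphic function" refers to sections of structure sheaves. -/

namespace LocalModel

variable {X : ComplexSpace.{u}} (c : X.Model) {J : Type} [Fintype J]

theorem analyticAt_f (y : c.U) (j : Fin c.k) : AnalyticAt ℂ (c.f j) (c.φ y) :=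
  c.analytic_f j (c.φ y) (c.range_φ.subset (Set.mem_range_self y)).1

/-- The germ at a point `(φ y, z)` of `D × ℂ^J` of the ideal sheaf of `A × ℂ^J`. -/
def prodIdeal (y : c.U) (z : J → ℂ) :
    Ideal (HolGerm ((c.φ y, z) : (Fin c.n → ℂ) × (J → ℂ))) :=
  Ideal.span (Set.range fun j => HolGerm.mk (fun p => c.f j p.1)
    (AnalyticAt.fun_comp (c.analyticAt_f y j) analyticAt_fst))

/-- The stalk of the structure sheaf of the model space `A × ℂ^J` at `(φ y, z)`. -/
abbrev ProdStalk (y : c.U) (z : J → ℂ) : Type :=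
  HolGerm ((c.φ y, z) : (Fin c.n → ℂ) × (J → ℂ)) ⧸ c.prodIdeal y z

/-- The tuple of germs at `y` of functions on `X` induced by a holomorphic map `Z` from a
neighbourhood of `φ y` to `ℂ^J`. -/
def pullVec (y : c.U) (Z : (Fin c.n → ℂ) → (J → ℂ)) (hZ : AnalyticAt ℂ Z (c.φ y)) :
    J → X.Stalk y.1 :=
  fun a => c.pull y (HolGerm.mk (fun w => Z w a) (analyticAt_pi_iff.mp hZ a))

/-- The germ at `y` of the function on `X` induced by `w ↦ F (w, Z w)`. -/
def pullComp (y : c.U) (F : (Fin c.n → ℂ) × (J → ℂ) → ℂ) (Z : (Fin c.n → ℂ) → (J → ℂ))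
    (hF : AnalyticAt ℂ F (c.φ y, Z (c.φ y))) (hZ : AnalyticAt ℂ Z (c.φ y)) : X.Stalk y.1 :=
  c.pull y (HolGerm.mk (fun w => F (w, Z w))
    (AnalyticAt.fun_comp (f := fun w => (w, Z w)) hF (analyticAt_id.prod hZ)))

end LocalModel

/-- A holomorphic function `F` on an open cone `N` in `ℂⁿ × ℂ^J`, homogeneous of degree `r` in the
second variable; off the zero section this is the same as a local section of `𝒪(r)` on
`ℂⁿ × ℙ(ℂ^J)`. -/
structure HomogFun (n : ℕ) (J : Type) [Fintype J] (r : ℕ) where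
  N : Set ((Fin n → ℂ) × (J → ℂ))
  isOpen_N : IsOpen N
  smul_mem : ∀ (w : Fin n → ℂ) (z : J → ℂ) (a : ℂ), a ≠ 0 → (w, z) ∈ N → (w, a • z) ∈ N
  F : (Fin n → ℂ) × (J → ℂ) → ℂ
  analytic_F : AnalyticOnNhd ℂ F N
  homog : ∀ (w : Fin n → ℂ) (z : J → ℂ) (a : ℂ), a ≠ 0 → (w, z) ∈ N →
    F (w, a • z) = a ^ r * F (w, z)

namespace HolBundle

variable {X : ComplexSpace.{u}}

/-- A global section of `𝒪(r)` on `ℙ(E)`, for a vector bundle `E` on a complex space `X`, i.e. a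
holomorphic function `s` on `E^*` minus its zero section which is homogeneous of degree `r` on the
fibres.

Such a function is recorded through its compositions with the germs of nowhere vanishing local
sections of `E^*`: if such a germ at `x` is given in the `i`-th trivialization by the row vector
`ζ ∈ 𝒪_{X,x}^{J i}`, with some entry a unit, then `val i x ζ ∈ 𝒪_{X,x}` is the germ of its
composition with `s`. (The values at other `ζ` have no meaning and are irrelevant.)

* `val_transition` says that the value depends only on the germ of a section of `E^*`, and not on
  the trivialization.
* `holo` says that `s` is a section of `𝒪(r)`: if `c` identifies an open part of `X` with the
  model space `A ⊆ D` of ideal `(f₁, …, f_k)`, then over it `s` is given by a section `σ` of the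
  quotient of the sheaf `𝒪(r)` on `D × ℙ` by the ideal `(f₁, …, f_k)`: by a family of germs modulo
  `(f₁, …, f_k)` which locally comes from holomorphic functions `F(w, z)` homogeneous of degree `r`
  in `z`; and `s` is composed with a section of `E^*` by substituting, for `z`, holomorphic
  functions `Z(w)` that represent it. -/
structure OSection (E : HolBundle X) (r : ℕ) where
  val : ∀ (i : E.ι) (x : X.Pt), x ∈ E.U i → (E.J i → X.Stalk x) → X.Stalk x
  val_transition : ∀ (i j : E.ι) (x : X.Pt) (hi : x ∈ E.U i) (hj : x ∈ E.U j)
    (ζ : E.J i → X.Stalk x), (∃ a, IsUnit (ζ a)) →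
    val j x hj (Matrix.vecMul ζ ((E.g i j).map (X.germ _ x (ComplexSpace.mem_inf hi hj)))) = val i x hi ζ
  holo : ∀ (i : E.ι) (c : X.Model),
    ∃ σ : ∀ (y : c.U) (z : E.J i → ℂ), c.ProdStalk y z,
      ∀ (x : c.U) (v : E.J i → ℂ), x.1 ∈ E.U i → v ≠ 0 →
        ∃ h : HomogFun c.n (E.J i) r, (c.φ x, v) ∈ h.N ∧
          (∀ (y : c.U) (z : E.J i → ℂ) (hN : (c.φ y, z) ∈ h.N), y.1 ∈ E.U i → z ≠ 0 →
            σ y z = Ideal.Quotient.mk _ (HolGerm.mk h.F (h.analytic_F _ hN))) ∧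
          (∀ (y : c.U) (hy : y.1 ∈ E.U i) (Z : (Fin c.n → ℂ) → (E.J i → ℂ))
            (hZ : AnalyticAt ℂ Z (c.φ y)) (hN : (c.φ y, Z (c.φ y)) ∈ h.N), Z (c.φ y) ≠ 0 →
            val i y.1 hy (c.pullVec y Z hZ) = c.pullComp y h.F Z (h.analytic_F _ hN) hZ)

/-- The section `s` of `𝒪(r)` generates the fibre of `𝒪(r)` at the point `(x, v^⊥)` of `ℙ(E)`, where
`v` is given by its coordinates in the `i`-th trivialization: `s` does not vanish at `(x, v)`. -/
def OSection.GeneratesAt {E : HolBundle X} {r : ℕ} (s : E.OSection r) (i : E.ι) (x : X.Pt)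
    (hx : x ∈ E.U i) (v : E.J i → ℂ) : Prop :=
  IsUnit (s.val i x hx fun a => X.constGerm x (v a))

/-- `𝒪(r)` on `ℙ(E)` is generated by global sections: at each point of `ℙ(E)`, with homogeneous
coordinates `v` in some trivialization, the fibre of `𝒪(r)` is generated by some global section. -/
def OIsGBS (E : HolBundle X) (r : ℕ) : Prop :=
  ∀ (i : E.ι) (x : X.Pt) (hx : x ∈ E.U i) (v : E.J i → ℂ), v ≠ 0 →
    ∃ s : E.OSection r, s.GeneratesAt i x hx v

end HolBundle

end CplxGeom

end

/-!
# Global generation of `𝒪(n r)` on `ℙ(E ⊗ F)`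

A point of `(E ⊗ F)^*` over `x` is a linear map `ζ` from `F_x` to `E_x^*`, in coordinates a matrix
with rows indexed by a frame of `E` and columns indexed by a frame of `F`. A global section of
`𝒪(r)` on `ℙ(E)` is a symmetric tensor `s` of degree `r` with coefficients in the structure sheaf
(`HolBundle.OSection.coeff`), and a global section `t` of `𝒪(r)` on `ℙ(F)` is carried by `ζ` to a
form `ζ t` of degree `r` on `E_x`. For every `q` the composition "differentiate
by `s`, then multiply by `ζ t`" is an endomorphism of a space of tensors of degree `r + q`
(`TensorWord.symOp`), of degree `r` in `ζ`. The trace of the product of `m` such endomorphisms, for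
sections `t₁, …, t_m`, is independent of the frames (`TensorWord.wordTrace_tmat`), so it is a global
section of `𝒪(m r)` on `ℙ(E ⊗ F)`, and its `n / m`-th power is one of `𝒪(n r)` if `m` divides `n`
(`HolBundle.tensorSection`).

*These sections have no common zero.* Let `W ⊆ E_x^*` be the image of `ζ ≠ 0`. The forms `ζ t` come
from forms on `W^*`, where they have no common zero, and `s` may be chosen not to vanish identically
on `W`. By the Nullstellensatz the forms `ζ t` generate all forms of large degree on `W^*`, and so,
dually, for `q` large the contractions of a non-zero form `f` on `W` with the `ζ t` are not all
zero; multiplied by `s` they are again non-zero forms, and this is how the transposed operators act.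
Hence some words of arbitrary length do not kill `f`, and a linear algebra argument gives a word of
non-zero trace (`exists_trace_word_ne_zero`): on a minimal invariant subspace containing forms that
do not vanish on `W`, some element of the algebra generated by the operators has
a fixed vector, thus a polynomial in it is a non-zero idempotent, of non-zero trace. That one `n`
serves for all bundles follows from Hilbert's basis theorem, applied to the polynomial ring in the
coefficients of `s` and of at most `e ^ r` tensors `ζ t` (`TensorWord.exists_length_dvd`,
`TensorWord.exists_uniform_length`).

*Sections of `𝒪(r)` are symmetric tensors.* As the space need not be reduced, a section is, on a
local model, only a family of holomorphic functions that agree modulo the ideal `(f₁, …, f_k)` of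
the model. Along the line `Z + τ e_a` it becomes a family of functions `F_τ` of `τ ∈ ℂ`, which agree
modulo the ideal and by homogeneity have a pole of order at most `r` at infinity. Modulo the ideal,
Liouville's theorem `IdealGerm.liouville` identifies the value at `τ = 0` with the coefficient of
order `r` in the expansion at infinity, which is a polynomial in `Z` whose coefficients come from
the Taylor expansion of the section at the vector `e_a`. No division with remainder in rings of
convergent power series is needed: with `τ = exp ξ`, primitives in `ξ` modulo the ideal form a
torsor under constants, whose monodromy along vertical segments of length `2π` is constant
(`IsPeriodicTorsor.monodromy_eq`); it is `2πi` times one of the two quantities far to the left, and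
`2πi` times the other far to the right.
-/

/-! ### Tensors and contraction operators over a commutative ring -/

namespace TensorWord

open Matrix

section Defs

variable {R : Type*} [CommRing R] {I J K : Type*} [Fintype I]

/-- The matrix of the tensor power `L^{⊗ I}`. -/
def tmat (I : Type*) [Fintype I] (L : Matrix J K R) : Matrix (I → J) (I → K) R :=
  fun α β => ∏ l, L (α l) (β l)

/-- The value at the vector `z` of the form with coefficient tensor `S`. -/
def tval [Fintype J] [DecidableEq I] (S : (I → J) → R) (z : J → R) : R :=
  ∑ α, S α * ∏ l, z (α l)

variable [Fintype J] [DecidableEq J]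

/-- The operator on tensors of degree `r + q` which contracts the first `r` slots with `S` and puts
`T` in their place. -/
def pairOp {r : ℕ} (q : ℕ) (S T : (Fin r → J) → R) :
    Matrix (Fin r ⊕ Fin q → J) (Fin r ⊕ Fin q → J) R :=
  (Matrix.kroneckerMap (· * ·) (vecMulVec T S) (1 : Matrix (Fin q → J) (Fin q → J) R)).submatrix
    (Equiv.sumArrowEquivProdArrow _ _ _) (Equiv.sumArrowEquivProdArrow _ _ _)

/-- The operator `pairOp` followed by symmetrization. On symmetric tensors, that is on homogeneous
polynomials of degree `r + q`, it is, up to a factor, the differential operator with symbol `S`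
followed by multiplication by the polynomial with coefficients `T`. -/
def symOp {r : ℕ} (q : ℕ) (S T : (Fin r → J) → R) :
    Matrix (Fin r ⊕ Fin q → J) (Fin r ⊕ Fin q → J) R :=
  fun α β => ∑ σ : Equiv.Perm (Fin r ⊕ Fin q), pairOp q S T (α ∘ σ) β

/-- The trace of a product of operators `symOp q S T`, where `T` runs through a list. -/
def wordTrace {r : ℕ} (q : ℕ) (S : (Fin r → J) → R) (Ts : List ((Fin r → J) → R)) : R :=
  trace (Ts.map (symOp q S)).prod

end Defs

section Lemmas

variable {R : Type*} [CommRing R] {I J J' K K' : Type*} [Fintype I]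

theorem tmat_mul [DecidableEq I] [Fintype K] (A : Matrix J K R) (B : Matrix K K' R) :
    tmat I (A * B) = tmat I A * tmat I B := by
  ext α β
  simp only [tmat, Matrix.mul_apply, Finset.prod_univ_sum, Fintype.piFinset_univ,
    Finset.prod_mul_distrib]

theorem tmat_one [DecidableEq J] [DecidableEq I] :
    tmat I (1 : Matrix J J R) = 1 := by
  ext α β
  simp only [tmat, Matrix.one_apply, Finset.prod_ite_zero, Finset.mem_univ, true_imp_iff,
    Finset.prod_const_one, funext_iff]

theorem tmat_transpose (A : Matrix J K R) :
    tmat I Aᵀ = (tmat I A)ᵀ := rfl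

theorem tmat_comp_perm (A : Matrix J K R) (σ : Equiv.Perm I) (α : I → J) (β : I → K) :
    tmat I A (α ∘ σ) (β ∘ σ) = tmat I A α β :=
  Equiv.prod_comp σ fun l => A (α l) (β l)

theorem tmat_sum {r q : ℕ} (A : Matrix J K R) :
    tmat (Fin r ⊕ Fin q) A =
      (Matrix.kroneckerMap (· * ·) (tmat (Fin r) A)
        (tmat (Fin q) A)).submatrix
        (Equiv.sumArrowEquivProdArrow _ _ _) (Equiv.sumArrowEquivProdArrow _ _ _) := by
  ext α β
  simp [tmat, Matrix.kroneckerMap_apply]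

theorem tmat_smul (a : R) (A : Matrix J K R) :
    tmat I (a • A) = a ^ Fintype.card I • tmat I A := by
  ext α β
  simp [tmat, Finset.prod_mul_distrib]

variable [Fintype J] [DecidableEq J] [Fintype J'] [DecidableEq J'] [Fintype K] [DecidableEq K]
  [Fintype K'] [DecidableEq K']

omit [DecidableEq J] [DecidableEq K] in
theorem tval_tmat_mulVec [DecidableEq I] (A : Matrix J K R) (S : (I → K) → R) (z : J → R) :
    tval (tmat I A *ᵥ S) z = tval S (z ᵥ* A) := by
  have h : ∀ β : I → K, (∏ l, (z ᵥ* A) (β l)) = ∑ α : I → J, (∏ l, z (α l)) * tmat I A α β := by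
    intro β
    simp only [Matrix.vecMul, dotProduct, Finset.prod_univ_sum, Fintype.piFinset_univ, tmat,
      Finset.prod_mul_distrib]
  simp only [tval, h, Matrix.mulVec, dotProduct, Finset.sum_mul, Finset.mul_sum]
  rw [Finset.sum_comm]
  refine Finset.sum_congr rfl fun β _ => Finset.sum_congr rfl fun α _ => ?_
  ring

theorem pairOp_mul_tmat {r q : ℕ} (L : Matrix J J' R) (S : (Fin r → J) → R)
    (T : (Fin r → J') → R) :
    pairOp q S (tmat (Fin r) L *ᵥ T) * tmat (Fin r ⊕ Fin q) L =
      tmat (Fin r ⊕ Fin q) L * pairOp q (S ᵥ* tmat (Fin r) L) T := by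
  rw [tmat_sum, pairOp, pairOp, Matrix.submatrix_mul_equiv, Matrix.submatrix_mul_equiv]
  congr 1
  have h1 := Matrix.mul_kronecker_mul (vecMulVec (tmat (Fin r) L *ᵥ T) S) (tmat (Fin r) L)
    (1 : Matrix (Fin q → J) (Fin q → J) R) (tmat (Fin q) L)
  have h2 := Matrix.mul_kronecker_mul (tmat (Fin r) L) (vecMulVec T (S ᵥ* tmat (Fin r) L))
    (tmat (Fin q) L) (1 : Matrix (Fin q → J') (Fin q → J') R)
  refine h1.symm.trans (Eq.trans ?_ h2)
  rw [Matrix.one_mul, Matrix.mul_one, Matrix.vecMulVec_mul, Matrix.mul_vecMulVec]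

/-- `symOp` is natural in the module, for arbitrary linear maps `L`. -/
theorem symOp_mul_tmat {r q : ℕ} (L : Matrix J J' R) (S : (Fin r → J) → R)
    (T : (Fin r → J') → R) :
    symOp q S (tmat (Fin r) L *ᵥ T) * tmat (Fin r ⊕ Fin q) L =
      tmat (Fin r ⊕ Fin q) L * symOp q (S ᵥ* tmat (Fin r) L) T := by
  ext α β
  have h := fun σ : Equiv.Perm (Fin r ⊕ Fin q) =>
    congrFun (congrFun (pairOp_mul_tmat (q := q) L S T) (α ∘ σ)) β
  simp only [Matrix.mul_apply] at h
  simp only [Matrix.mul_apply, symOp, Finset.sum_mul, Finset.mul_sum]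
  rw [Finset.sum_comm]
  conv_rhs => rw [Finset.sum_comm]
  refine Finset.sum_congr rfl fun σ _ => ?_
  rw [h, ← Equiv.sum_comp (Equiv.arrowCongr σ⁻¹ (Equiv.refl J'))]
  refine Finset.sum_congr rfl fun γ _ => ?_
  have hc : (Equiv.arrowCongr σ⁻¹ (Equiv.refl J')) γ = γ ∘ σ := by
    ext l; simp [Equiv.arrowCongr]; rfl
  rw [hc, tmat_comp_perm]

theorem prod_symOp_mul_tmat {r q : ℕ} (L : Matrix J J' R) (S : (Fin r → J) → R)
    (Ts : List ((Fin r → J') → R)) :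
    (Ts.map fun T => symOp q S (tmat (Fin r) L *ᵥ T)).prod * tmat (Fin r ⊕ Fin q) L =
      tmat (Fin r ⊕ Fin q) L * (Ts.map (symOp q (S ᵥ* tmat (Fin r) L))).prod := by
  induction Ts with
  | nil => simp
  | cons T Ts ih =>
    simp only [List.map_cons, List.prod_cons]
    rw [Matrix.mul_assoc, ih, ← Matrix.mul_assoc, symOp_mul_tmat, Matrix.mul_assoc]

/-- The word traces are invariant under changes of coordinates. -/
theorem wordTrace_tmat {r q : ℕ} (L : Matrix J J' R) (L' : Matrix J' J R) (h : L * L' = 1)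
    (h' : L' * L = 1) (S : (Fin r → J) → R) (Ts : List ((Fin r → J') → R)) :
    wordTrace q S (Ts.map (tmat (Fin r) L *ᵥ ·)) = wordTrace q (S ᵥ* tmat (Fin r) L) Ts := by
  have hp := prod_symOp_mul_tmat (q := q) L S Ts
  have h1 : tmat (Fin r ⊕ Fin q) L * tmat (Fin r ⊕ Fin q) L' = 1 := by
    rw [← tmat_mul, h, tmat_one]
  have h2 : tmat (Fin r ⊕ Fin q) L' * tmat (Fin r ⊕ Fin q) L = 1 := by
    rw [← tmat_mul, h', tmat_one]
  have h3 := congrArg (· * tmat (Fin r ⊕ Fin q) L') hp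
  simp only [Matrix.mul_assoc, h1, Matrix.mul_one] at h3
  unfold wordTrace
  rw [List.map_map, show (symOp q S ∘ fun T => tmat (Fin r) L *ᵥ T) =
    fun T => symOp q S (tmat (Fin r) L *ᵥ T) from rfl, h3, Matrix.trace_mul_comm,
    Matrix.mul_assoc, h2, Matrix.mul_one]

omit [Fintype J] in
theorem pairOp_apply {r q : ℕ} (S T : (Fin r → J) → R) (α β : Fin r ⊕ Fin q → J) :
    pairOp q S T α β = T (α ∘ Sum.inl) * S (β ∘ Sum.inl) *
      (if α ∘ Sum.inr = β ∘ Sum.inr then 1 else 0) := by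
  rw [pairOp, Matrix.submatrix_apply, Matrix.kroneckerMap_apply, vecMulVec_apply, Matrix.one_apply]
  rfl

omit [Fintype J] in
theorem symOp_smul {r q : ℕ} (S T : (Fin r → J) → R) (a : R) :
    symOp q S (a • T) = a • symOp q S T := by
  ext α β
  simp only [symOp, pairOp_apply, Matrix.smul_apply, Pi.smul_apply, smul_eq_mul, Finset.mul_sum]
  exact Finset.sum_congr rfl fun σ _ => by ring

theorem wordTrace_smul {r q : ℕ} (S : (Fin r → J) → R) (Ts : List ((Fin r → J) → R)) (a : R) :
    wordTrace q S (Ts.map (a • ·)) = a ^ Ts.length * wordTrace q S Ts := by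
  have : (Ts.map fun T => symOp q S (a • T)).prod = a ^ Ts.length • (Ts.map (symOp q S)).prod := by
    induction Ts with
    | nil => simp
    | cons T Ts ih =>
      rw [List.map_cons, List.prod_cons, ih, symOp_smul, List.map_cons, List.prod_cons,
        List.length_cons, smul_mul_smul_comm, pow_succ']
  unfold wordTrace
  rw [List.map_map, ← smul_eq_mul, ← Matrix.trace_smul, ← this]
  rfl

variable {R' : Type*} [CommRing R']

omit [Fintype J] in
theorem map_symOp (f : R →+* R') {r q : ℕ} (S T : (Fin r → J) → R) :
    (symOp q S T).map f = symOp q (f ∘ S) (f ∘ T) := by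
  ext α β
  simp only [symOp, pairOp_apply, Matrix.map_apply, map_sum, map_mul, Function.comp]
  refine Finset.sum_congr rfl fun σ _ => ?_
  split_ifs <;> simp

theorem map_wordTrace (f : R →+* R') {r q : ℕ} (S : (Fin r → J) → R)
    (Ts : List ((Fin r → J) → R)) :
    f (wordTrace q S Ts) = wordTrace q (f ∘ S) (Ts.map (f ∘ ·)) := by
  have : ((Ts.map (symOp q S)).prod).map f = ((Ts.map (f ∘ ·)).map (symOp q (f ∘ S))).prod := by
    induction Ts with
    | nil => simp
    | cons T Ts ih =>
      simp only [List.map_cons, List.prod_cons]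
      rw [Matrix.map_mul, ih, map_symOp]
  rw [wordTrace, wordTrace, ← this, Matrix.trace, Matrix.trace, map_sum]
  rfl

omit [DecidableEq J] [Fintype J'] [DecidableEq J'] [Fintype K] [DecidableEq K]
  [Fintype K'] [DecidableEq K'] in
theorem map_tval [DecidableEq I] (f : R →+* R') (S : (I → J) → R) (z : J → R) :
    f (tval S z) = tval (f ∘ S) (f ∘ z) := by
  simp [tval]

omit [Fintype J] [DecidableEq J] [DecidableEq K] in
theorem map_tmat_mulVec [DecidableEq I] (f : R →+* R') (A : Matrix J K R) (S : (I → K) → R) :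
    f ∘ (tmat I A *ᵥ S) = tmat I (A.map f) *ᵥ (f ∘ S) := by
  ext α
  simp [Matrix.mulVec, dotProduct, tmat]

end Lemmas

end TensorWord

/-! ### Traces of words in linear operators -/

section NilArgument

variable {k V ι : Type*} [Field k] [CharZero k] [AddCommGroup V] [Module k V]
  [FiniteDimensional k V]

open Polynomial in
/-- A subspace of endomorphisms closed under multiplication, one of whose elements has the
eigenvalue `1`, contains a non-zero idempotent, hence an endomorphism of non-zero trace. -/
theorem Submodule.exists_trace_ne_zero_of_apply_eq_self (A : Submodule k (Module.End k V))
    (hA : ∀ a ∈ A, ∀ b ∈ A, a * b ∈ A) {a : Module.End k V} (ha : a ∈ A) {v : V} (hv : v ≠ 0)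
    (hav : a v = v) : ∃ e ∈ A, LinearMap.trace k V e ≠ 0 := by
  have hm0 : minpoly k a ≠ 0 := minpoly.ne_zero (Algebra.IsIntegral.isIntegral a)
  obtain ⟨g, hg, hdvd⟩ := Polynomial.exists_eq_pow_rootMultiplicity_mul_and_not_dvd _ hm0 (0 : k)
  set n := (minpoly k a).rootMultiplicity 0
  rw [C_0, sub_zero] at hg hdvd
  have hcop : IsCoprime ((X : k[X]) ^ (n + 1)) g :=
    ((irreducible_X (R := k)).coprime_iff_not_dvd.mpr hdvd).pow_left
  obtain ⟨u, w, huw⟩ := hcop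
  have heig : ∀ p : k[X], aeval a p v = p.eval 1 • v := fun p =>
    Module.End.aeval_apply_of_hasEigenvector
      ⟨Module.End.mem_eigenspace_iff.mpr (by simpa using hav), hv⟩
  have hzero : aeval a (X ^ (n + 1) * g) = 0 := by
    rw [pow_succ', mul_assoc, ← hg, map_mul, minpoly.aeval, mul_zero]
  have hg1 : g.eval 1 = 0 := by
    have := heig (X ^ (n + 1) * g)
    rw [hzero] at this
    simpa [hv] using this.symm
  -- the projection to the sum of the generalized eigenspaces for non-zero eigenvalues, a polynomial
  -- in `a` without constant term
  set e := aeval a (u * X ^ (n + 1)) with he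
  have hev : e v = v := by
    rw [he, heig]
    have := congrArg (Polynomial.eval 1) huw
    rw [eval_add, eval_mul (p := w), hg1, mul_zero, add_zero, eval_one] at this
    rw [this, one_smul]
  have hpow : ∀ i : ℕ, a ^ (i + 1) ∈ A := by
    intro i
    induction i with
    | zero => simpa using ha
    | succ i ih => rw [pow_succ]; exact hA _ ih _ ha
  refine ⟨e, ?_, fun htr => hv ?_⟩
  · have : e = ∑ i ∈ (u * X ^ n).support, (u * X ^ n).coeff i • a ^ (i + 1) := by
      rw [he, pow_succ, ← mul_assoc, map_mul, aeval_X,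
        aeval_eq_sum_range' (n := (u * X ^ n).natDegree + 1) (Nat.lt_succ_self _)]
      rw [Finset.sum_mul, ← Finset.sum_subset (supp_subset_range_natDegree_succ)]
      · exact Finset.sum_congr rfl fun i _ => by rw [smul_mul_assoc, pow_succ]
      · intro i _ hi
        rw [notMem_support_iff.mp hi, zero_smul, zero_mul]
    rw [this]
    exact Submodule.sum_mem _ fun i _ => A.smul_mem _ (hpow i)
  · have hidem : IsIdempotentElem e := by
      have h1 : e * (1 - e) = 0 := by
        have h2 : (1 : Module.End k V) - e = aeval a (w * g) := by
          rw [he, ← map_one (aeval (R := k) a), ← map_sub, ← huw, add_sub_cancel_left]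
        rw [h2, he, ← map_mul, show u * X ^ (n + 1) * (w * g) = u * w * (X ^ (n + 1) * g) by ring,
          map_mul, hzero, mul_zero]
      rw [IsIdempotentElem]
      rw [mul_sub, mul_one, sub_eq_zero] at h1
      exact h1.symm
    have h0 : e = 0 := LinearMap.IsIdempotentElem.eq_zero_of_trace_eq_zero hidem htr
    rw [← hev, h0, LinearMap.zero_apply]

/-- If no finite sequence of the operators `N i` can force every vector into the set `B`, then some
product of the operators `N i` has non-zero trace. The reason is that on a minimal invariant
subspace not contained in `B` some element of the algebra generated by the `N i` has a fixed
vector. -/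
theorem exists_trace_word_ne_zero (N : ι → Module.End k V) (B : Set V) (h0 : (0 : V) ∈ B)
    {v₀ : V} (hv₀ : v₀ ∉ B) (hB : ∀ v ∉ B, ∃ i, N i v ∉ B) :
    ∃ l : List ι, l ≠ [] ∧ LinearMap.trace k V (l.map N).prod ≠ 0 := by
  set G : Set (Module.End k V) := {a | ∃ l : List ι, l ≠ [] ∧ (l.map N).prod = a} with hG
  set A := Submodule.span k G with hAdef
  have hGmul : ∀ a ∈ G, ∀ b ∈ G, a * b ∈ G := by
    rintro _ ⟨l, hl, rfl⟩ _ ⟨l', hl', rfl⟩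
    exact ⟨l ++ l', by simp [hl], by simp⟩
  have hNG : ∀ i, N i ∈ G := fun i => ⟨[i], by simp, by simp⟩
  have hA : ∀ a ∈ A, ∀ b ∈ A, a * b ∈ A := by
    intro a ha b hb
    induction ha using Submodule.span_induction with
    | mem a ha =>
      induction hb using Submodule.span_induction with
      | mem b hb => exact Submodule.subset_span (hGmul a ha b hb)
      | zero => simp
      | add x y _ _ hx hy => rw [mul_add]; exact A.add_mem hx hy
      | smul c x _ hx => rw [mul_smul_comm]; exact A.smul_mem _ hx
    | zero => simp
    | add x y _ _ hx hy => rw [add_mul]; exact A.add_mem hx hy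
    | smul c x _ hx => rw [smul_mul_assoc]; exact A.smul_mem _ hx
  set P : Set (Submodule k V) := {U | (∀ i, ∀ x ∈ U, N i x ∈ U) ∧ ∃ x ∈ U, x ∉ B}
  obtain ⟨U, ⟨hU, v, hvU, hvB⟩, hmin⟩ := (wellFounded_lt (α := Submodule k V)).has_min P
    ⟨⊤, fun _ _ _ => trivial, v₀, trivial, hv₀⟩
  have hlU : ∀ l : List ι, ∀ x ∈ U, (l.map N).prod x ∈ U := by
    intro l
    induction l with
    | nil => intro x hx; simpa using hx
    | cons i l ih =>
      intro x hx
      rw [List.map_cons, List.prod_cons, Module.End.mul_apply]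
      exact hU i _ (ih x hx)
  have hAU : ∀ a ∈ A, a v ∈ U := by
    intro a ha
    induction ha using Submodule.span_induction with
    | mem a ha => obtain ⟨l, -, rfl⟩ := ha; exact hlU l v hvU
    | zero => simp
    | add x y _ _ hx hy => exact U.add_mem hx hy
    | smul c x _ hx => exact U.smul_mem _ hx
  -- by minimality the invariant subspace `A v` is `U`, so that some element of `A` fixes `v`
  set U' := A.map (LinearMap.applyₗ v) with hU'
  have hU'P : U' ∈ P := by
    refine ⟨?_, ?_⟩
    · rintro i _ ⟨a, ha, rfl⟩
      exact ⟨N i * a, hA _ (Submodule.subset_span (hNG i)) _ ha, rfl⟩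
    · obtain ⟨i, hi⟩ := hB v hvB
      exact ⟨N i v, ⟨N i, Submodule.subset_span (hNG i), rfl⟩, hi⟩
  have hle : U' ≤ U := by
    rintro _ ⟨a, ha, rfl⟩
    exact hAU a ha
  have hvU' : v ∈ U' := by
    rcases hle.lt_or_eq with hlt | heq
    · exact absurd hlt (hmin U' hU'P)
    · rw [heq]; exact hvU
  obtain ⟨a, ha, hav⟩ := hvU'
  have hv : v ≠ 0 := fun h => hvB (h ▸ h0)
  obtain ⟨e, he, htr⟩ := A.exists_trace_ne_zero_of_apply_eq_self hA ha hv hav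
  by_contra! hcon
  refine htr ?_
  clear htr
  induction he using Submodule.span_induction with
  | mem a ha => obtain ⟨l, hl, rfl⟩ := ha; exact hcon l hl
  | zero => simp
  | add x y _ _ hx hy => rw [map_add, hx, hy, add_zero]
  | smul c x _ hx => rw [map_smul, hx, smul_zero]

end NilArgument

/-! ### Symmetric tensors and polynomials -/

namespace TensorWord

open MvPolynomial

section Mon

variable {I J : Type*} [Fintype I]

/-- The exponent of the monomial `∏ l, X (α l)`. -/
noncomputable def mon (α : I → J) : J →₀ ℕ := ∑ l, Finsupp.single (α l) 1

theorem mon_apply [DecidableEq J] (α : I → J) (j : J) :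
    mon α j = Fintype.card {l // α l = j} := by
  simp [mon, Finsupp.finsetSum_apply, Finsupp.single_apply, Fintype.card_subtype]

theorem mon_comp_perm (α : I → J) (σ : Equiv.Perm I) : mon (α ∘ σ) = mon α :=
  Equiv.sum_comp σ fun l => Finsupp.single (α l) 1

/-- Monomials are index tuples up to permutation. -/
theorem exists_perm_of_mon_eq {α β : I → J} (h : mon α = mon β) :
    ∃ σ : Equiv.Perm I, β ∘ σ = α := by
  classical
  have e : ∀ j, Nonempty ({l // α l = j} ≃ {l // β l = j}) := fun j => by
    have hj := DFunLike.congr_fun h j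
    rw [mon_apply, mon_apply] at hj
    exact Fintype.card_eq.mp hj
  refine ⟨Equiv.ofFiberEquiv fun j => (e j).some, funext fun l => Equiv.ofFiberEquiv_map _ l⟩

theorem degree_mon (α : I → J) : (mon α).degree = Fintype.card I := by
  simp [mon, map_sum, Finsupp.degree_single]

theorem exists_mon_eq {q : ℕ} (m : J →₀ ℕ) (hm : m.degree = q) : ∃ γ : Fin q → J, mon γ = m := by
  classical
  induction q generalizing m with
  | zero =>
    refine ⟨Fin.elim0, ?_⟩
    rw [(Finsupp.degree_eq_zero_iff m).mp hm]
    simp [mon]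
  | succ q ih =>
    have hne : m ≠ 0 := by rintro rfl; simp at hm
    obtain ⟨j, hj⟩ := Finsupp.ne_iff.mp hne
    have hle : Finsupp.single j 1 ≤ m := by
      rw [Finsupp.single_le_iff]
      exact Nat.one_le_iff_ne_zero.mpr hj
    have hsplit : Finsupp.single j 1 + (m - Finsupp.single j 1) = m := add_tsub_cancel_of_le hle
    have hdeg := congrArg Finsupp.degree hsplit
    rw [map_add, Finsupp.degree_single, hm] at hdeg
    obtain ⟨γ, hγ⟩ := ih (m - Finsupp.single j 1) (by omega)
    refine ⟨Fin.cons j γ, ?_⟩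
    rw [← hsplit, ← hγ]
    simp [mon, Fin.sum_univ_succ]

theorem mon_sumElim {r q : ℕ} (δ : Fin r → J) (γ : Fin q → J) :
    mon (Sum.elim δ γ) = mon δ + mon γ := by
  simp [mon]

variable {R : Type*} [CommRing R]

theorem monomial_mon (α : I → J) (c : R) :
    monomial (mon α) c = C c * ∏ l, (X (α l) : MvPolynomial J R) := by
  rw [mon, monomial_sum_index]
  rfl

variable [Fintype J] [DecidableEq I]

/-- The polynomial with the coefficient tensor `f`. -/
noncomputable def polyOf (f : (I → J) → R) : MvPolynomial J R :=
  ∑ α, monomial (mon α) (f α)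

theorem eval_polyOf (f : (I → J) → R) (z : J → R) : eval z (polyOf f) = tval f z := by
  simp [polyOf, tval, monomial_mon]

/-- A symmetric tensor is determined by its polynomial. -/
theorem eq_zero_of_polyOf_eq_zero [CharZero R] [NoZeroDivisors R] {f : (I → J) → R}
    (hf : ∀ (σ : Equiv.Perm I) (α : I → J), f (α ∘ σ) = f α) (h : polyOf f = 0) : f = 0 := by
  classical
  funext α
  have hc := congrArg (coeff (mon α)) h
  simp only [polyOf, coeff_sum, coeff_monomial, coeff_zero] at hc
  rw [← Finset.sum_filter, Finset.sum_congr rfl (g := fun _ => f α)] at hc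
  · rw [Finset.sum_const, nsmul_eq_mul, mul_eq_zero, Nat.cast_eq_zero, Finset.card_eq_zero] at hc
    rcases hc with hc | hc
    · exact absurd (hc ▸ (Finset.mem_filter.mpr ⟨Finset.mem_univ α, rfl⟩ :
        α ∈ Finset.univ.filter fun β => mon β = mon α)) (by simp)
    · exact hc
  · intro β hβ
    obtain ⟨σ, rfl⟩ := exists_perm_of_mon_eq (Finset.mem_filter.mp hβ).2
    exact hf σ α

/-- A symmetric tensor with coefficients in a `ℂ`-algebra is determined by its values at the
vectors with constant non-zero coordinates. -/
theorem eq_zero_of_tval_const_eq_zero (κ : ℂ →+* R) {f : (I → J) → R}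
    (hf : ∀ (σ : Equiv.Perm I) (α : I → J), f (α ∘ σ) = f α)
    (h : ∀ z : J → ℂ, (∀ j, z j ≠ 0) → tval f (κ ∘ z) = 0) : f = 0 := by
  let _ := κ.toAlgebra
  funext α
  -- linear functionals reduce the claim to complex polynomials
  rw [Pi.zero_apply, ← Module.forall_dual_apply_eq_zero_iff ℂ]
  intro l
  have hl : (l ∘ f) = 0 := by
    refine eq_zero_of_polyOf_eq_zero (fun σ α => congrArg l (hf σ α)) ?_
    refine funext_set (fun _ => {z : ℂ | z ≠ 0}) (fun _ => ?_) ?_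
    · exact (Set.finite_singleton (0 : ℂ)).infinite_compl
    · intro z hz
      rw [eval_polyOf, map_zero]
      have := congrArg l (h z fun j => hz j trivial)
      rw [map_zero] at this
      rw [← this]
      simp only [tval, map_sum, Function.comp]
      refine Finset.sum_congr rfl fun α _ => ?_
      rw [← map_prod, mul_comm (f α), show κ (∏ l, z (α l)) * f α = (∏ l, z (α l)) • f α from
        (Algebra.smul_def _ _).symm, map_smul, smul_eq_mul, mul_comm]
  exact congrFun hl α

/-- The symmetrization of a tensor. -/
def symm (f : (I → J) → R) (α : I → J) : R := ∑ σ : Equiv.Perm I, f (α ∘ σ)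

omit [Fintype J] in
theorem symm_comp_perm (f : (I → J) → R) (τ : Equiv.Perm I) (α : I → J) :
    symm f (α ∘ τ) = symm f α := by
  rw [symm, symm]
  conv_rhs => rw [← Equiv.sum_comp (Equiv.mulLeft τ)]
  rfl

theorem tval_symm (f : (I → J) → R) (z : J → R) :
    tval (symm f) z = (Fintype.card I).factorial * tval f z := by
  have h : ∀ σ : Equiv.Perm I, ∑ α : I → J, f (α ∘ σ) * ∏ l, z (α l) = tval f z := by
    intro σ
    rw [tval, ← Equiv.sum_comp (Equiv.arrowCongr σ (Equiv.refl J))]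
    refine Finset.sum_congr rfl fun α _ => ?_
    have h1 : (Equiv.arrowCongr σ (Equiv.refl J)) α = α ∘ σ.symm := rfl
    have h2 : (α ∘ σ.symm) ∘ σ = α := funext fun l => congrArg α (σ.symm_apply_apply l)
    rw [h1, h2]
    exact congrArg _ (Equiv.prod_comp σ.symm fun l => z (α l))
  simp only [tval, symm, Finset.sum_mul]
  rw [Finset.sum_comm, Finset.sum_congr rfl fun σ _ => h σ]
  simp [Fintype.card_perm, tval]

end Mon

end TensorWord

/-! ### Non-vanishing of word traces -/

namespace TensorWord

open MvPolynomial Matrix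

section Core

variable {J ι : Type*} [Fintype J] [DecidableEq J] {r : ℕ}

omit [DecidableEq J] in
/-- Forms without a common zero generate all monomials of large degree. -/
theorem exists_monomial_mem_span (T : ι → (Fin r → J) → ℂ)
    (hT : ∀ x : J → ℂ, x ≠ 0 → ∃ i, tval (T i) x ≠ 0) :
    ∃ N : ℕ, ∀ m : J →₀ ℕ, N < m.degree →
      (monomial m 1 : MvPolynomial J ℂ) ∈ Ideal.span (Set.range fun i => polyOf (T i)) := by
  set 𝔱 : Ideal (MvPolynomial J ℂ) := Ideal.span (Set.range fun i => polyOf (T i)) with h𝔱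
  have hX : ∀ j, ∃ n, (X j : MvPolynomial J ℂ) ^ n ∈ 𝔱 := by
    intro j
    have : (X j : MvPolynomial J ℂ) ∈ 𝔱.radical := by
      rw [← vanishingIdeal_zeroLocus_eq_radical (K := ℂ), mem_vanishingIdeal_iff]
      intro x hx
      have hx0 : x = 0 := by
        by_contra hne
        obtain ⟨i, hi⟩ := hT x hne
        refine hi ?_
        have := hx _ (Ideal.subset_span ⟨i, rfl⟩)
        rw [← eval_polyOf]
        exact this
      simp [hx0]
    exact this
  choose n hn using hX
  refine ⟨∑ j, n j, fun m hm => ?_⟩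
  have hj : ∃ j, n j ≤ m j := by
    by_contra! hcon
    refine absurd hm (not_lt.mpr ?_)
    rw [Finsupp.degree_eq_sum]
    exact Finset.sum_le_sum fun j _ => (hcon j).le
  obtain ⟨j, hj⟩ := hj
  have hm' : m = Finsupp.single j (n j) + (m - Finsupp.single j (n j)) :=
    (add_tsub_cancel_of_le (Finsupp.single_le_iff.mpr hj)).symm
  rw [hm', ← one_mul (1 : ℂ), ← monomial_mul, ← X_pow_eq_monomial]
  exact Ideal.mul_mem_right _ _ (hn j)

/-- The contraction of the symmetrization of `f` with `T` in the first `r` slots. -/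
def contr {q : ℕ} (T : (Fin r → J) → ℂ) (f : (Fin r ⊕ Fin q → J) → ℂ) (γ : Fin q → J) : ℂ :=
  ∑ δ, T δ * symm f (Sum.elim δ γ)

/-- The transpose of `symOp q S T` acts on forms by contraction with `T` followed by multiplication
by `S`. -/
theorem tval_vecMul_symOp {q : ℕ} (S T : (Fin r → J) → ℂ) (f : (Fin r ⊕ Fin q → J) → ℂ)
    (z : J → ℂ) : tval (f ᵥ* symOp q S T) z = tval S z * tval (contr T f) z := by
  have h : ∀ β : Fin r ⊕ Fin q → J,
      (f ᵥ* symOp q S T) β = S (β ∘ Sum.inl) * contr T f (β ∘ Sum.inr) := by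
    intro β
    have h1 : ∀ σ : Equiv.Perm (Fin r ⊕ Fin q), ∑ α, f α * pairOp q S T (α ∘ σ) β =
        ∑ α, f (α ∘ σ.symm) * pairOp q S T α β := by
      intro σ
      rw [← Equiv.sum_comp (Equiv.arrowCongr σ (Equiv.refl J))]
      refine Finset.sum_congr rfl fun α _ => ?_
      have h2 : (Equiv.arrowCongr σ (Equiv.refl J)) α = α ∘ σ.symm := rfl
      have h3 : (α ∘ σ.symm) ∘ σ = α := funext fun l => congrArg α (σ.symm_apply_apply l)
      rw [h2, h3]
    have h4 : ∑ σ : Equiv.Perm (Fin r ⊕ Fin q), ∑ α, f (α ∘ σ.symm) * pairOp q S T α β =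
        ∑ α, symm f α * pairOp q S T α β := by
      rw [Finset.sum_comm]
      refine Finset.sum_congr rfl fun α _ => ?_
      rw [← Finset.sum_mul, symm, ← Equiv.sum_comp (Equiv.inv (Equiv.Perm (Fin r ⊕ Fin q)))]
      rfl
    simp only [vecMul, dotProduct, symOp, Finset.mul_sum]
    rw [Finset.sum_comm, Finset.sum_congr rfl fun σ _ => h1 σ, h4,
      ← Equiv.sum_comp (Equiv.sumArrowEquivProdArrow (Fin r) (Fin q) J).symm, Fintype.sum_prod_type,
      contr, Finset.mul_sum]
    refine Finset.sum_congr rfl fun δ _ => ?_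
    rw [Finset.sum_eq_single (β ∘ Sum.inr)]
    · rw [pairOp_apply]
      have h5 : (Equiv.sumArrowEquivProdArrow (Fin r) (Fin q) J).symm (δ, β ∘ Sum.inr) =
        Sum.elim δ (β ∘ Sum.inr) := rfl
      rw [h5, Sum.elim_comp_inl, Sum.elim_comp_inr, if_pos rfl]
      ring
    · intro γ _ hγ
      have h5 : (Equiv.sumArrowEquivProdArrow (Fin r) (Fin q) J).symm (δ, γ) =
        Sum.elim δ γ := rfl
      rw [pairOp_apply, h5, Sum.elim_comp_inr, if_neg hγ, mul_zero, mul_zero]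
    · exact fun h => absurd (Finset.mem_univ _) h
  simp only [tval, h]
  rw [← Equiv.sum_comp (Equiv.sumArrowEquivProdArrow (Fin r) (Fin q) J).symm,
    Fintype.sum_prod_type, Finset.sum_mul_sum]
  refine Finset.sum_congr rfl fun δ _ => Finset.sum_congr rfl fun γ _ => ?_
  have h5 : (Equiv.sumArrowEquivProdArrow (Fin r) (Fin q) J).symm (δ, γ) =
        Sum.elim δ γ := rfl
  rw [h5, Sum.elim_comp_inl, Sum.elim_comp_inr, Fintype.prod_sum_type]
  simp only [Sum.elim_inl, Sum.elim_inr]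
  ring

omit [DecidableEq J] in
theorem contr_comp_perm {q : ℕ} (T : (Fin r → J) → ℂ) (f : (Fin r ⊕ Fin q → J) → ℂ)
    (σ : Equiv.Perm (Fin q)) (γ : Fin q → J) : contr T f (γ ∘ σ) = contr T f γ := by
  refine Finset.sum_congr rfl fun δ _ => ?_
  have : Sum.elim δ (γ ∘ σ) = Sum.elim δ γ ∘ (Equiv.sumCongr (Equiv.refl _) σ) := by
    ext l; cases l <;> rfl
  rw [this, symm_comp_perm]

/-- If the contractions of the form `f` with forms `T i` without common zero all vanish, then `f`
vanishes, provided its degree is large: its symmetrization induces a linear functional on the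
polynomials which vanishes on the ideal generated by the `T i`. -/
theorem symm_eq_zero_of_contr_eq_zero {q : ℕ} (T : ι → (Fin r → J) → ℂ) {N : ℕ}
    (hN : ∀ m : J →₀ ℕ, N < m.degree →
      (monomial m 1 : MvPolynomial J ℂ) ∈ Ideal.span (Set.range fun i => polyOf (T i)))
    (hq : N < r + q) (f : (Fin r ⊕ Fin q → J) → ℂ) (h : ∀ i, contr (T i) f = 0) :
    symm f = 0 := by
  classical
  -- `cnt α` is the number of index tuples that give the same monomial as `α`
  set cnt : (Fin r ⊕ Fin q → J) → ℂ := fun α =>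
    ((Finset.univ.filter fun β : Fin r ⊕ Fin q → J => mon β = mon α).card : ℂ) with hcnt
  set F : MvPolynomial J ℂ →ₗ[ℂ] ℂ := ∑ α, (symm f α / cnt α) • lcoeff ℂ (mon α) with hF
  have hFapply : ∀ p, F p = ∑ α, symm f α / cnt α * coeff (mon α) p := by
    intro p; simp [hF]
  have hF1 : ∀ α c, F (monomial (mon α) c) = symm f α * c := by
    intro α c
    have hpos : cnt α ≠ 0 := by
      rw [hcnt, Nat.cast_ne_zero]
      exact Finset.card_ne_zero_of_mem (Finset.mem_filter.mpr ⟨Finset.mem_univ α, rfl⟩)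
    rw [hFapply]
    simp only [coeff_monomial, mul_ite, mul_zero]
    rw [← Finset.sum_filter, Finset.sum_congr rfl (g := fun _ => symm f α / cnt α * c)]
    · have : ((Finset.univ.filter fun β : Fin r ⊕ Fin q → J => mon α = mon β).card : ℂ) =
          cnt α := by
        simp only [hcnt, eq_comm]
      rw [Finset.sum_const, nsmul_eq_mul, this]
      field_simp
    · intro β hβ
      have hm := (Finset.mem_filter.mp hβ).2
      obtain ⟨σ, rfl⟩ := exists_perm_of_mon_eq hm.symm
      rw [symm_comp_perm]
      simp only [hcnt, mon_comp_perm]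
  have hF2 : ∀ i (m : J →₀ ℕ) (c : ℂ), F (monomial m c * polyOf (T i)) = 0 := by
    intro i m c
    by_cases hm : m.degree = q
    · obtain ⟨γ, rfl⟩ := exists_mon_eq m hm
      have : (monomial (mon γ) c * polyOf (T i) : MvPolynomial J ℂ) =
          ∑ δ, monomial (mon (Sum.elim δ γ)) (c * T i δ) := by
        rw [polyOf, Finset.mul_sum]
        refine Finset.sum_congr rfl fun δ _ => ?_
        rw [monomial_mul, mon_sumElim, add_comm]
      rw [this, map_sum]
      simp only [hF1]
      have hi := congrFun (h i) γ
      rw [contr, Pi.zero_apply] at hi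
      rw [← mul_zero c, ← hi, Finset.mul_sum]
      exact Finset.sum_congr rfl fun δ _ => by ring
    · rw [hFapply]
      refine Finset.sum_eq_zero fun α _ => ?_
      rw [polyOf, Finset.mul_sum, coeff_sum, Finset.sum_eq_zero, mul_zero]
      intro δ _
      rw [monomial_mul, coeff_monomial, if_neg]
      intro heq
      have := congrArg Finsupp.degree heq
      rw [map_add, degree_mon, degree_mon, Fintype.card_sum, Fintype.card_fin, Fintype.card_fin]
        at this
      omega
  have hF3 : ∀ p ∈ Ideal.span (Set.range fun i => polyOf (T i)), ∀ s, F (s * p) = 0 := by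
    intro p hp
    induction hp using Submodule.span_induction with
    | mem p hp =>
      obtain ⟨i, rfl⟩ := hp
      intro s
      induction s using MvPolynomial.induction_on' with
      | monomial m c => exact hF2 i m c
      | add a b ha hb => rw [add_mul, map_add, ha, hb, add_zero]
    | zero => simp
    | add x y _ _ hx hy => intro s; rw [mul_add, map_add, hx, hy, add_zero]
    | smul a x _ hx => intro s; rw [smul_eq_mul, ← mul_assoc, hx]
  funext α
  have h1 := hF3 _ (hN (mon α) (by rw [degree_mon]; simpa using hq)) 1
  rwa [one_mul, hF1, mul_one] at h1

/-- If the restriction of `S` along the injection `L` is non-zero and the forms `T i` on the source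
of `L` have no common zero, then some word trace in `S` and the forms `T i` is non-zero: as long as
a form `f` is non-zero, some contraction with a `T i` is, by `symm_eq_zero_of_contr_eq_zero`, and
multiplication by the restriction of `S` keeps it so. Hence `exists_trace_word_ne_zero` applies to
the transposed operators. -/
theorem exists_wordTrace_ne_zero {J' : Type*} [Fintype J'] [DecidableEq J'] (L : Matrix J' J ℂ)
    (L' : Matrix J J' ℂ) (hL : L' * L = 1) (S : (Fin r → J') → ℂ) {z₀ : J → ℂ}
    (hS : tval (S ᵥ* tmat (Fin r) L) z₀ ≠ 0) [Nonempty J]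
    (T : ι → (Fin r → J) → ℂ) (hT : ∀ x : J → ℂ, x ≠ 0 → ∃ i, tval (T i) x ≠ 0) :
    ∃ (q : ℕ) (l : List ι), l ≠ [] ∧ wordTrace q S (l.map fun i => tmat (Fin r) L *ᵥ T i) ≠ 0 := by
  obtain ⟨N, hN⟩ := exists_monomial_mem_span T hT
  set q := N + 1 with hq
  have hstep : ∀ f : (Fin r ⊕ Fin q → J) → ℂ, polyOf f ≠ 0 →
      ∃ i, polyOf (f ᵥ* symOp q (S ᵥ* tmat (Fin r) L) (T i)) ≠ 0 := by
    intro f hf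
    by_contra! hcon
    refine hf ?_
    have hc : ∀ i, contr (T i) f = 0 := by
      intro i
      refine eq_zero_of_polyOf_eq_zero (contr_comp_perm (T i) f) ?_
      have hprod : polyOf (S ᵥ* tmat (Fin r) L) * polyOf (contr (T i) f) = 0 := by
        refine MvPolynomial.funext fun z => ?_
        rw [map_mul, eval_polyOf, eval_polyOf, ← tval_vecMul_symOp, ← eval_polyOf, hcon i]
      refine (mul_eq_zero.mp hprod).resolve_left fun h0 => hS ?_
      rw [← eval_polyOf, h0, map_zero]
    have hs := symm_eq_zero_of_contr_eq_zero (q := q) T hN (by omega) f hc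
    refine MvPolynomial.funext fun z => ?_
    have h1 := tval_symm f z
    rw [hs] at h1
    have h2 : (((Fintype.card (Fin r ⊕ Fin q)).factorial : ℕ) : ℂ) ≠ 0 :=
      Nat.cast_ne_zero.mpr (Nat.factorial_ne_zero _)
    rw [eval_polyOf, map_zero]
    refine (mul_eq_zero.mp (h1.symm.trans ?_)).resolve_left h2
    simp [tval]
  obtain ⟨j⟩ := ‹Nonempty J›
  have hv₀ : polyOf (Pi.single (fun _ : Fin r ⊕ Fin q => j) 1 : (Fin r ⊕ Fin q → J) → ℂ) ≠ 0 := by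
    intro h0
    have := congrArg (eval fun _ => (1 : ℂ)) h0
    rw [eval_polyOf, map_zero] at this
    simp [tval] at this
  have hLL : tmat (Fin r ⊕ Fin q) L' * tmat (Fin r ⊕ Fin q) L = 1 := by
    rw [← tmat_mul, hL, tmat_one]
  obtain ⟨l, hl, htr⟩ := exists_trace_word_ne_zero
    (fun i => Matrix.toLin' (symOp q S (tmat (Fin r) L *ᵥ T i))ᵀ)
    {f | polyOf (f ᵥ* tmat (Fin r ⊕ Fin q) L) = 0} (by simp [polyOf])
    (v₀ := Pi.single (fun _ : Fin r ⊕ Fin q => j) 1 ᵥ* tmat (Fin r ⊕ Fin q) L')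
    (by rwa [Set.mem_ofPred_eq, Matrix.vecMul_vecMul, hLL, Matrix.vecMul_one]) (by
      intro f hf
      obtain ⟨i, hi⟩ := hstep _ hf
      refine ⟨i, ?_⟩
      rwa [Set.mem_ofPred_eq, Matrix.toLin'_apply, Matrix.mulVec_transpose, Matrix.vecMul_vecMul,
        symOp_mul_tmat, ← Matrix.vecMul_vecMul])
  refine ⟨q, l.reverse, by simpa using hl, ?_⟩
  have h1 : ∀ l : List ι,
      (l.map fun i => Matrix.toLin' (symOp q S (tmat (Fin r) L *ᵥ T i))ᵀ).prod =
      Matrix.toLin' ((l.reverse.map fun i => symOp q S (tmat (Fin r) L *ᵥ T i)).prod)ᵀ := by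
    intro l
    induction l with
    | nil => simp; rfl
    | cons i l ih =>
      rw [List.map_cons, List.prod_cons, ih, List.reverse_cons, List.map_append, List.prod_append,
        List.map_singleton, List.prod_singleton, Matrix.transpose_mul, Matrix.toLin'_mul]
      rfl
  rw [h1, Matrix.trace_toLin'_eq, Matrix.trace_transpose] at htr
  rwa [wordTrace, List.map_map]

end Core

section Uniform

variable {r : ℕ}

/-- By Hilbert's basis theorem, the lengths of the words that are needed divide a common number: as
polynomials in the coefficients of `S` and the `T j`, finitely many word traces generate the ideal
of all of them. -/
theorem exists_length_dvd (r e N : ℕ) : ∃ n : ℕ, 0 < n ∧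
    ∀ (S : (Fin r → Fin e) → ℂ) (T : Fin N → (Fin r → Fin e) → ℂ),
      (∃ (q : ℕ) (l : List (Fin N)), l ≠ [] ∧ wordTrace q S (l.map T) ≠ 0) →
      ∃ (q : ℕ) (l : List (Fin N)), l ≠ [] ∧ l.length ∣ n ∧ wordTrace q S (l.map T) ≠ 0 := by
  classical
  let A := MvPolynomial ((Fin r → Fin e) ⊕ (Fin N × (Fin r → Fin e))) ℂ
  let gen : ℕ × List (Fin N) → A := fun p =>
    wordTrace p.1 (fun δ => X (Sum.inl δ)) (p.2.map fun i δ => X (Sum.inr (i, δ)))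
  have hgen : ∀ (S : (Fin r → Fin e) → ℂ) (T : Fin N → (Fin r → Fin e) → ℂ) p,
      MvPolynomial.eval (Sum.elim S fun x => T x.1 x.2) (gen p) =
        wordTrace p.1 S (p.2.map T) := by
    intro S T p
    rw [map_wordTrace, List.map_map]
    congr 1
    · ext δ; simp
    · congr 1
      ext i δ; simp
  obtain ⟨s, hs, hspan⟩ := (Submodule.fg_span_iff_fg_span_finset_subset (R := A)
    (gen '' {p | p.2 ≠ []})).mp (IsNoetherian.noetherian _)
  have hs' : ∀ x ∈ s, ∃ p : ℕ × List (Fin N), p.2 ≠ [] ∧ gen p = x := fun x hx => hs hx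
  choose! p hp1 hp2 using hs'
  refine ⟨∏ x ∈ s, (p x).2.length, Finset.prod_pos fun x hx =>
    List.length_pos_of_ne_nil (hp1 x hx), fun S T ⟨q, l, hl, hne⟩ => ?_⟩
  by_contra! hcon
  refine hne ?_
  have hmem : gen (q, l) ∈ Submodule.span A (s : Set A) := by
    rw [← hspan]
    exact Submodule.subset_span ⟨(q, l), hl, rfl⟩
  have hker : Submodule.span A (s : Set A) ≤
      RingHom.ker (MvPolynomial.eval (Sum.elim S fun x => T x.1 x.2)) := by
    refine Submodule.span_le.mpr fun x hx => ?_
    rw [SetLike.mem_coe, RingHom.mem_ker, ← hp2 x hx, hgen]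
    exact hcon _ _ (hp1 x hx) (Finset.dvd_prod_of_mem _ hx)
  have := hker hmem
  rwa [RingHom.mem_ker, hgen] at this

/-- A matrix factors through its image. -/
theorem exists_rank_factorization {J K : Type*} [Fintype J] [DecidableEq J] [Fintype K]
    [DecidableEq K] (ζ : Matrix J K ℂ) : ∃ (k : ℕ) (L : Matrix J (Fin k) ℂ)
      (L' : Matrix (Fin k) J ℂ) (ζ' : Matrix (Fin k) K ℂ), ζ = L * ζ' ∧ L' * L = 1 ∧
      ∀ x, x ᵥ* ζ' = 0 → x = 0 := by
  let b := Module.finBasis ℂ (LinearMap.range (Matrix.toLin' ζ))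
  let ρ := b.equivFun.toLinearMap ∘ₗ (Matrix.toLin' ζ).rangeRestrict
  let lam := (LinearMap.range (Matrix.toLin' ζ)).subtype ∘ₗ b.equivFun.symm.toLinearMap
  obtain ⟨lam', hlam'⟩ := lam.exists_leftInverse_of_injective (LinearMap.ker_eq_bot.mpr
    ((Submodule.injective_subtype _).comp b.equivFun.symm.injective))
  refine ⟨_, LinearMap.toMatrix' lam, LinearMap.toMatrix' lam', LinearMap.toMatrix' ρ, ?_, ?_, ?_⟩
  · rw [← LinearMap.toMatrix'_comp]
    have : lam ∘ₗ ρ = Matrix.toLin' ζ := by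
      ext x
      simp [lam, ρ]
    rw [this, LinearMap.toMatrix'_toLin']
  · rw [← LinearMap.toMatrix'_comp, hlam', LinearMap.toMatrix'_id]
  · intro x hx
    have hρ : Function.Surjective ρ :=
      b.equivFun.surjective.comp (LinearMap.surjective_rangeRestrict _)
    refine dotProduct_eq_zero _ fun w => ?_
    obtain ⟨y, rfl⟩ := hρ w
    rw [← LinearMap.toMatrix'_mulVec, Matrix.dotProduct_mulVec, hx, zero_dotProduct]

/-- Word traces detect non-zero points `ζ` of a tensor product: if the families `S` and `T` of forms
have no common zeros, then a word trace in some `S i` and in the pullbacks of the `T k` along `ζ` is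
non-zero, with a uniform bound on the word length. -/
theorem exists_uniform_length (r e : ℕ) : ∃ n : ℕ, 0 < n ∧
    ∀ {J K : Type} [Fintype J] [DecidableEq J] [Fintype K] [DecidableEq K] {ι κ : Type*}
      (S : ι → (Fin r → J) → ℂ) (T : κ → (Fin r → K) → ℂ) (ζ : Matrix J K ℂ),
      Fintype.card J = e → ζ ≠ 0 → (∀ x : J → ℂ, x ≠ 0 → ∃ i, tval (S i) x ≠ 0) →
      (∀ x : K → ℂ, x ≠ 0 → ∃ i, tval (T i) x ≠ 0) →
      ∃ (i : ι) (q : ℕ) (l : List κ), l ≠ [] ∧ l.length ∣ n ∧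
        wordTrace q (S i) (l.map fun k => tmat (Fin r) ζ *ᵥ T k) ≠ 0 := by
  classical
  obtain ⟨n, hn, H⟩ := exists_length_dvd r e (Fintype.card (Fin r → Fin e))
  refine ⟨n, hn, ?_⟩
  intro J K _ _ _ _ ι κ S T ζ hJ hζ hS hT
  obtain ⟨k, L, L', ζ', rfl, hL, hζ'⟩ := exists_rank_factorization ζ
  have hk : Nonempty (Fin k) := by
    by_contra hk
    rw [not_nonempty_iff] at hk
    exact hζ (by ext a b; simp [Matrix.mul_apply])
  obtain ⟨s₀⟩ := id hk
  set e₀ : Fin k → ℂ := Pi.single s₀ 1 with he₀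
  have he₀' : e₀ ≠ 0 := fun h => by simpa [he₀] using congrFun h s₀
  have hLinj : L *ᵥ e₀ ≠ 0 := by
    intro h
    apply he₀'
    rw [← Matrix.one_mulVec e₀, ← hL, ← Matrix.mulVec_mulVec, h, Matrix.mulVec_zero]
  obtain ⟨i, hi⟩ := hS _ hLinj
  have hi' : tval (S i ᵥ* tmat (Fin r) L) e₀ ≠ 0 := by
    rw [← Matrix.mulVec_transpose, ← tmat_transpose, tval_tmat_mulVec, Matrix.vecMul_transpose]
    exact hi
  obtain ⟨k₀, -⟩ := hT _ fun h => he₀' (hζ' e₀ h)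
  -- finitely many of the pullbacks suffice, as many as the dimension of the space of tensors
  set U := Set.range fun k => tmat (Fin r) (L * ζ') *ᵥ T k with hU
  obtain ⟨f, hfU, hfspan, -⟩ := Submodule.exists_fun_fin_finrank_span_eq ℂ U
  choose c hc using hfU
  have hfin : Module.finrank ℂ (Submodule.span ℂ U) ≤ Fintype.card (Fin r → Fin e) := by
    refine (Submodule.finrank_le _).trans ?_
    rw [Module.finrank_pi]
    simp [hJ]
  -- `c` padded to a fixed length
  let c' : Fin (Fintype.card (Fin r → Fin e)) → κ := fun j =>
    if h : (j : ℕ) < Module.finrank ℂ (Submodule.span ℂ U) then c ⟨j, h⟩ else k₀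
  have hfc : ∀ j, ∃ j', f j = tmat (Fin r) (L * ζ') *ᵥ T (c' j') := by
    intro j
    refine ⟨⟨j, j.2.trans_le hfin⟩, ?_⟩
    simp only [c', j.2, dif_pos, ← hc]
  obtain ⟨q, l, hl, htr⟩ := exists_wordTrace_ne_zero L L' hL (S i) hi'
    (fun j => tmat (Fin r) ζ' *ᵥ T (c' j)) (by
      intro x hx
      by_contra! hcon
      obtain ⟨k, hk⟩ := hT (x ᵥ* ζ') fun h => hx (hζ' x h)
      refine hk ?_
      have hx' : x = (x ᵥ* L') ᵥ* L := by rw [Matrix.vecMul_vecMul, hL, Matrix.vecMul_one]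
      have hval : ∀ k, tval (tmat (Fin r) ζ' *ᵥ T k) x =
          tval (tmat (Fin r) (L * ζ') *ᵥ T k) (x ᵥ* L') := by
        intro k
        rw [tmat_mul, ← Matrix.mulVec_mulVec, tval_tmat_mulVec _ (tmat (Fin r) ζ' *ᵥ T k), ← hx']
      rw [← tval_tmat_mulVec, hval]
      let Λ : ((Fin r → J) → ℂ) →ₗ[ℂ] ℂ :=
        { toFun := fun s => tval s (x ᵥ* L')
          map_add' := fun a b => by simp [tval, add_mul, Finset.sum_add_distrib]
          map_smul' := fun a b => by simp [tval, Finset.mul_sum, mul_assoc] }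
      have hle : Submodule.span ℂ U ≤ LinearMap.ker Λ := by
        rw [← hfspan, Submodule.span_le]
        rintro _ ⟨j, rfl⟩
        obtain ⟨j', hj'⟩ := hfc j
        rw [SetLike.mem_coe, LinearMap.mem_ker, hj']
        exact (hval _).symm.trans (hcon j')
      exact hle (Submodule.subset_span ⟨k, rfl⟩))
  -- transport to the index set `Fin e`
  let ε : Fin e ≃ J := (Fintype.equivFinOfCardEq hJ).symm
  let Q : Matrix J (Fin e) ℂ := (1 : Matrix J J ℂ).submatrix id ε
  let Q' : Matrix (Fin e) J ℂ := (1 : Matrix J J ℂ).submatrix ε id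
  have hQ : Q * Q' = 1 := by
    simp only [Q, Q', Matrix.submatrix_mul_equiv, Matrix.mul_one, Matrix.submatrix_id_id]
  have hQ' : Q' * Q = 1 := by
    change (1 : Matrix J J ℂ).submatrix ε (Equiv.refl J) *
      (1 : Matrix J J ℂ).submatrix (Equiv.refl J) ε = 1
    rw [Matrix.submatrix_mul_equiv, Matrix.mul_one, Matrix.submatrix_one_equiv]
  have hred : ∀ q (l : List (Fin (Fintype.card (Fin r → Fin e)))),
      wordTrace q (S i) (l.map fun j => tmat (Fin r) (L * ζ') *ᵥ T (c' j)) =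
        wordTrace q (S i ᵥ* tmat (Fin r) Q)
          (l.map fun j => tmat (Fin r) (Q' * (L * ζ')) *ᵥ T (c' j)) := by
    intro q l
    rw [← wordTrace_tmat Q Q' hQ hQ', List.map_map]
    congr 2
    funext j
    rw [Function.comp, Matrix.mulVec_mulVec, ← tmat_mul, ← Matrix.mul_assoc, hQ, Matrix.one_mul]
  obtain ⟨q', l', hl', hdvd, htr'⟩ := H (S i ᵥ* tmat (Fin r) Q)
    (fun j => tmat (Fin r) (Q' * (L * ζ')) *ᵥ T (c' j)) ⟨q, l, hl, by
      rw [← hred]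
      convert htr using 4
      rw [Matrix.mulVec_mulVec, ← tmat_mul]⟩
  refine ⟨i, q', l'.map c', by simpa using hl', by simpa using hdvd, ?_⟩
  rw [← hred] at htr'
  rwa [List.map_map]

end Uniform

end TensorWord

/-! ### Averages, primitives and Taylor expansions of analytic functions with parameters -/

section Averages

open MeasureTheory

variable {P : Type*} [NormedAddCommGroup P] [NormedSpace ℂ P]

/-- The average of an analytic function over a continuous family of linear contractions fixing the
base point is analytic: its power series is the average of the power series. -/
theorem AnalyticAt.integral_comp_contraction {H : P → ℂ} {p₀ : P} (hH : AnalyticAt ℂ H p₀)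
    {L : ℝ → P →L[ℂ] P} (hL : Continuous L) (hL1 : ∀ t ∈ Set.Icc (0 : ℝ) 1, ‖L t‖ ≤ 1) :
    AnalyticAt ℂ (fun p => ∫ t in (0 : ℝ)..1, H (p₀ + L t (p - p₀))) p₀ := by
  obtain ⟨p, r, hp⟩ := hH
  obtain ⟨ρ, hρ0, hρr⟩ := ENNReal.lt_iff_exists_nnreal_btwn.mp hp.r_pos
  obtain ⟨a, ⟨ha0, ha1⟩, C, hC, hbound⟩ :=
    p.norm_mul_pow_le_mul_pow_of_lt_radius (hρr.trans_le hp.r_le)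
  have hcont : ∀ m, Continuous fun t => (p m).compContinuousLinearMap fun _ => L t := fun m =>
    (ContinuousMultilinearMap.compContinuousLinearMapLRight (E := fun _ : Fin m => P)
      (p m)).cont.comp (continuous_pi fun _ => hL)
  let q : FormalMultilinearSeries ℂ P ℂ := fun m =>
    ∫ t in (0 : ℝ)..1, (p m).compContinuousLinearMap fun _ => L t
  have hIoc : ∀ t ∈ Set.uIoc (0 : ℝ) 1, t ∈ Set.Icc (0 : ℝ) 1 := fun t ht => by
    rw [Set.uIoc_of_le zero_le_one] at ht
    exact Set.Ioc_subset_Icc_self ht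
  have hqnorm : ∀ m, ‖q m‖ ≤ ‖p m‖ := by
    intro m
    have := intervalIntegral.norm_integral_le_of_norm_le_const (a := 0) (b := 1) (C := ‖p m‖)
      (f := fun t => (p m).compContinuousLinearMap fun _ => L t) (fun t ht => by
        refine (ContinuousMultilinearMap.norm_compContinuousLinearMap_le _ _).trans ?_
        refine mul_le_of_le_one_right (norm_nonneg _) ?_
        exact Finset.prod_le_one (fun _ _ => norm_nonneg _) fun _ _ => hL1 t (hIoc t ht))
    simpa using this
  refine ⟨q, ρ, ?_, hρ0, ?_⟩
  · refine q.le_radius_of_bound C fun m => ?_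
    calc ‖q m‖ * ρ ^ m ≤ ‖p m‖ * ρ ^ m := by gcongr; exact hqnorm m
      _ ≤ C * a ^ m := hbound m
      _ ≤ C := mul_le_of_le_one_right hC.le (pow_le_one₀ ha0.le ha1.le)
  · intro y hy
    have hy' : ‖y‖ < ρ := by
      simpa using hy
    have hval : ∀ m, q m (fun _ => y) = ∫ t in (0 : ℝ)..1, p m fun _ => L t y := by
      intro m
      have := (ContinuousMultilinearMap.apply ℂ (fun _ : Fin m => P) ℂ
        fun _ => y).intervalIntegral_comp_comm (μ := volume) (a := 0) (b := 1)
        ((hcont m).intervalIntegrable _ _)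
      exact this.symm
    simp only [hval]
    have hLy : ∀ t ∈ Set.Icc (0 : ℝ) 1, ‖L t y‖ ≤ ‖y‖ := fun t ht =>
      ((L t).le_opNorm y).trans (mul_le_of_le_one_left (norm_nonneg _) (hL1 t ht))
    refine intervalIntegral.hasSum_integral_of_dominated_convergence (fun m _ => C * a ^ m) ?_ ?_ ?_
      ?_ ?_
    · intro m
      refine Continuous.aestronglyMeasurable ?_
      exact (ContinuousMultilinearMap.apply ℂ (fun _ : Fin m => P) ℂ fun _ => y).continuous.comp
        (hcont m)
    · intro m
      refine Filter.Eventually.of_forall fun t ht => ?_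
      refine ((p m).le_opNorm _).trans ?_
      rw [Finset.prod_const, Finset.card_univ, Fintype.card_fin]
      refine le_trans ?_ (hbound m)
      gcongr
      exact (hLy t (hIoc t ht)).trans hy'.le
    · exact Filter.Eventually.of_forall fun t _ =>
        (summable_geometric_of_lt_one ha0.le ha1).mul_left C
    · exact intervalIntegrable_const
    · refine Filter.Eventually.of_forall fun t ht => ?_
      rw [add_sub_cancel_left]
      refine hp.hasSum ?_
      have : ‖L t y‖ < ρ := (hLy t (hIoc t ht)).trans_lt hy'
      refine Metric.eball_subset_eball hρr.le ?_
      simpa using this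

variable {V Z : Type*} [NormedAddCommGroup V] [NormedSpace ℂ V] [NormedAddCommGroup Z]
  [NormedSpace ℂ Z]

theorem AnalyticAt.integral_segment {H : V × Z → ℂ} {b : V} {c : Z}
    (hH : AnalyticAt ℂ H (b, c)) :
    AnalyticAt ℂ (fun p : V × Z => ∫ t in (0 : ℝ)..1, H (p.1, c + (t : ℂ) • (p.2 - c))) (b, c) := by
  let L : ℝ → V × Z →L[ℂ] V × Z := fun t =>
    (ContinuousLinearMap.inl ℂ V Z).comp (ContinuousLinearMap.fst ℂ V Z) +
      (t : ℂ) • (ContinuousLinearMap.inr ℂ V Z).comp (ContinuousLinearMap.snd ℂ V Z)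
  have hLapply : ∀ t (p : V × Z), L t p = (p.1, (t : ℂ) • p.2) := fun t p => by simp [L]
  have hL : Continuous L := by fun_prop
  have := hH.integral_comp_contraction hL fun t ht => by
    refine ContinuousLinearMap.opNorm_le_bound _ zero_le_one fun p => ?_
    rw [hLapply, one_mul, Prod.norm_def, Prod.norm_def]
    refine max_le_max le_rfl ?_
    rw [norm_smul]
    refine mul_le_of_le_one_left (norm_nonneg _) ?_
    rw [Complex.norm_real, Real.norm_of_nonneg ht.1]
    exact ht.2
  refine this.congr (Filter.Eventually.of_forall fun p => ?_)
  simp [hLapply]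

/-- Near a point, an analytic function is analytic at all points of a product of balls. -/
theorem AnalyticAt.exists_ball_prod {H : V × Z → ℂ} {b : V} {c : Z}
    (hH : AnalyticAt ℂ H (b, c)) : ∃ ε > 0, ∀ w ∈ Metric.ball b ε, ∀ z ∈ Metric.ball c ε,
      AnalyticAt ℂ H (w, z) := by
  obtain ⟨ε, hε, h⟩ := Metric.eventually_nhds_iff_ball.mp hH.eventually_analyticAt
  refine ⟨ε, hε, fun w hw z hz => h _ ?_⟩
  rw [← ball_prod_same]
  exact ⟨hw, hz⟩

omit [NormedSpace ℂ V] [NormedSpace ℂ Z] in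
theorem eventually_mem_ball_prod {b : V} {c : Z} {ε : ℝ} (hε : 0 < ε) :
    ∀ᶠ p : V × Z in 𝓝 (b, c), p.1 ∈ Metric.ball b ε ∧ p.2 ∈ Metric.ball c ε := by
  have := Metric.ball_mem_nhds (b, c) hε
  rw [← ball_prod_same] at this
  exact this

/-- Analytic functions have analytic primitives with respect to the last variable. -/
theorem AnalyticAt.exists_primitive {h : V × ℂ → ℂ} {b : V} {c : ℂ} (hh : AnalyticAt ℂ h (b, c)) :
    ∃ B : V × ℂ → ℂ, AnalyticAt ℂ B (b, c) ∧
      ∀ᶠ p : V × ℂ in 𝓝 (b, c), HasDerivAt (fun η => B (p.1, η)) (h p) p.2 := by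
  obtain ⟨ε, hε, hA⟩ := hh.exists_ball_prod
  refine ⟨fun p => (p.2 - c) * ∫ t in (0 : ℝ)..1, h (p.1, c + (t : ℂ) • (p.2 - c)),
    (analyticAt_snd.sub analyticAt_const).mul hh.integral_segment, ?_⟩
  filter_upwards [eventually_mem_ball_prod hε] with p hp
  have hd : ∀ z ∈ Metric.ball c ε, DifferentiableAt ℂ (fun z => h (p.1, z)) z := fun z hz =>
    ((hA p.1 hp.1 z hz).comp (analyticAt_const.prod analyticAt_id)).differentiableAt
  obtain ⟨g, hg⟩ := DifferentiableOn.isExactOn_ball (c := c) (r := ε) (f := fun z => h (p.1, z))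
    fun z hz => (hd z hz).differentiableWithinAt
  have hseg : ∀ z ∈ Metric.ball c ε, ∀ t ∈ Set.Icc (0 : ℝ) 1,
      c + t • (z - c) ∈ Metric.ball c ε := fun z hz t ht =>
    (convex_ball c ε).add_smul_sub_mem (Metric.mem_ball_self hε) hz ht
  have heq : ∀ z ∈ Metric.ball c ε,
      (z - c) * ∫ t in (0 : ℝ)..1, h (p.1, c + (t : ℂ) • (z - c)) = g z - g c := by
    intro z hz
    have := intervalIntegral.integral_unitInterval_deriv_eq_sub (f := g)
      (f' := fun z => h (p.1, z)) (z₀ := c) (z₁ := z - c) ?_ ?_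
    · rw [add_sub_cancel, smul_eq_mul] at this
      rw [← this]
      rfl
    · intro t ht
      refine ContinuousAt.continuousWithinAt ?_
      exact ContinuousAt.comp (g := fun z => h (p.1, z)) (hd _ (hseg z hz t ht)).continuousAt
        (by fun_prop)
    · exact fun t ht => hg _ (hseg z hz t ht)
  refine ((hg p.2 hp.2).sub_const (g c)).congr_of_eventuallyEq ?_
  filter_upwards [Metric.isOpen_ball.mem_nhds hp.2] with z hz
  exact heq z hz

variable {J : Type*} [Fintype J]

/-- Hadamard's lemma with parameters. -/
theorem AnalyticAt.exists_hadamard [DecidableEq J] {H : V × (J → ℂ) → ℂ} {b : V} {c : J → ℂ}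
    (hH : AnalyticAt ℂ H (b, c)) :
    ∃ K : J → V × (J → ℂ) → ℂ, (∀ a, AnalyticAt ℂ (K a) (b, c)) ∧
      ∀ᶠ p : V × (J → ℂ) in 𝓝 (b, c), H p = H (p.1, c) + ∑ a, (p.2 a - c a) * K a p := by
  let D : J → V × (J → ℂ) → ℂ := fun a p => fderiv ℂ H p (0, Pi.single a 1)
  have hD : ∀ p, AnalyticAt ℂ H p → ∀ a, AnalyticAt ℂ (D a) p := fun p hp a =>
    (ContinuousLinearMap.analyticAt (ContinuousLinearMap.apply ℂ ℂ
      ((0, Pi.single a 1) : V × (J → ℂ))) _).comp hp.fderiv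
  refine ⟨fun a p => ∫ t in (0 : ℝ)..1, D a (p.1, c + (t : ℂ) • (p.2 - c)),
    fun a => (hD _ hH a).integral_segment, ?_⟩
  obtain ⟨ε, hε, hA⟩ := hH.exists_ball_prod
  filter_upwards [eventually_mem_ball_prod hε] with p hp
  obtain ⟨w, z⟩ := p
  have hseg : ∀ t ∈ Set.Icc (0 : ℝ) 1, c + (t : ℂ) • (z - c) ∈ Metric.ball c ε := fun t ht =>
    (convex_ball c ε).add_smul_sub_mem (Metric.mem_ball_self hε) hp.2 ht
  have hAt : ∀ t ∈ Set.Icc (0 : ℝ) 1, AnalyticAt ℂ H (w, c + (t : ℂ) • (z - c)) := fun t ht =>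
    hA w hp.1 _ (hseg t ht)
  have hderiv : ∀ t ∈ Set.Icc (0 : ℝ) 1, HasDerivAt (fun t : ℝ => H (w, c + (t : ℂ) • (z - c)))
      (∑ a, (z a - c a) * D a (w, c + (t : ℂ) • (z - c))) t := by
    intro t ht
    have h1 : HasDerivAt (fun t : ℝ => ((w, c + (t : ℂ) • (z - c)) : V × (J → ℂ)))
        ((0, z - c) : V × (J → ℂ)) t := by
      refine (hasDerivAt_const t w).prodMk ?_
      have := (((hasDerivAt_id t).ofReal_comp).smul_const (z - c)).const_add c
      simpa using this
    have h2 := ((hAt t ht).differentiableAt.hasFDerivAt.restrictScalars ℝ).comp_hasDerivAt t h1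
    have h3 : ((0, z - c) : V × (J → ℂ)) =
        ∑ a, (z a - c a) • ((0, Pi.single a 1) : V × (J → ℂ)) := by
      refine Prod.ext ?_ ?_
      · simp [Prod.fst_sum]
      · rw [Prod.snd_sum]
        funext a
        simp [Pi.single_apply]
    have h4 : ∑ a, (z a - c a) * D a (w, c + (t : ℂ) • (z - c)) =
        fderiv ℂ H (w, c + (t : ℂ) • (z - c)) (0, z - c) := by
      rw [h3, map_sum]
      exact Finset.sum_congr rfl fun a _ => by rw [map_smul, smul_eq_mul]
    rw [h4]
    exact h2
  have hDint : ∀ a, ContinuousOn (fun t : ℝ => D a (w, c + (t : ℂ) • (z - c))) (Set.Icc 0 1) :=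
    fun a t ht => ContinuousAt.continuousWithinAt (ContinuousAt.comp (g := D a)
      (hD _ (hAt t ht) a).continuousAt (by fun_prop))
  have hcont : ContinuousOn (fun t : ℝ => ∑ a, (z a - c a) * D a (w, c + (t : ℂ) • (z - c)))
      (Set.Icc 0 1) :=
    continuousOn_finsetSum _ fun a _ => continuousOn_const.mul (hDint a)
  have hu : Set.uIcc (0 : ℝ) 1 = Set.Icc 0 1 := Set.uIcc_of_le zero_le_one
  have hftc := intervalIntegral.integral_eq_sub_of_hasDerivAt (a := 0) (b := 1)
    (fun t ht => hderiv t (hu ▸ ht)) (ContinuousOn.intervalIntegrable (hu ▸ hcont))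
  rw [intervalIntegral.integral_finsetSum fun a _ =>
    (ContinuousOn.intervalIntegrable (hu ▸ hDint a)).const_mul _] at hftc
  simp only [intervalIntegral.integral_const_mul, Complex.ofReal_one, one_smul, Complex.ofReal_zero,
    zero_smul, add_zero, add_sub_cancel] at hftc
  rw [hftc]
  ring

/-- Taylor's formula with parameters. -/
theorem AnalyticAt.exists_taylor [DecidableEq J] {H : V × (J → ℂ) → ℂ} {b : V} {c : J → ℂ}
    (hH : AnalyticAt ℂ H (b, c)) (n : ℕ) :
    ∃ (A : ∀ m : ℕ, (Fin m → J) → V → ℂ) (K : (Fin n → J) → V × (J → ℂ) → ℂ),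
      (∀ m α, AnalyticAt ℂ (A m α) b) ∧ (∀ α, AnalyticAt ℂ (K α) (b, c)) ∧
      ∀ᶠ p : V × (J → ℂ) in 𝓝 (b, c), H p =
        (∑ m ∈ Finset.range n, ∑ α : Fin m → J, A m α p.1 * ∏ l, (p.2 (α l) - c (α l))) +
          ∑ α, K α p * ∏ l, (p.2 (α l) - c (α l)) := by
  induction n with
  | zero =>
    exact ⟨fun _ _ _ => 0, fun _ => H, fun _ _ => analyticAt_const, fun _ => hH, by simp⟩
  | succ n ih =>
    obtain ⟨A, K, hA, hK, hAK⟩ := ih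
    choose K' hK' hKK' using fun α => (hK α).exists_hadamard
    refine ⟨fun m α => if h : m = n then fun w => K (h ▸ α) (w, c) else A m α,
      fun β => K' (Fin.tail β) (β 0), fun m α => ?_, fun β => hK' _ _, ?_⟩
    · dsimp only
      split_ifs with h
      · exact (hK _).comp (f := fun w => (w, c)) (analyticAt_id.prod analyticAt_const)
      · exact hA m α
    · filter_upwards [hAK, Filter.eventually_all.mpr hKK'] with p h1 h2
      rw [h1, Finset.sum_range_succ, add_assoc]
      congr 1
      · refine Finset.sum_congr rfl fun m hm => Finset.sum_congr rfl fun α _ => ?_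
        rw [dif_neg (Finset.mem_range.mp hm).ne]
      · simp only [dif_pos]
        rw [← Equiv.sum_comp (Fin.consEquiv fun _ => J), Fintype.sum_prod_type, Finset.sum_comm,
          ← Finset.sum_add_distrib]
        refine Finset.sum_congr rfl fun α _ => ?_
        rw [h2 α, add_mul, Finset.sum_mul]
        congr 1
        refine Finset.sum_congr rfl fun a _ => ?_
        simp only [Fin.consEquiv, Equiv.coe_fn_mk, Fin.tail_cons, Fin.cons_zero, Fin.prod_univ_succ,
          Fin.cons_succ]
        ring

end Averages

/-! ### Monodromy of local primitives along vertical segments -/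

/-- A predicate `Pr ψ η`, read as "`ψ` is near `η` a section of `Pr`", defines a torsor under a
constant sheaf of abelian groups on `ℂ` which is invariant under translation by `2πi`. -/
structure IsPeriodicTorsor {G : Type*} [AddCommGroup G] (Pr : (ℂ → G) → ℂ → Prop) : Prop where
  eventually : ∀ {ψ η}, Pr ψ η → ∀ᶠ η' in 𝓝 η, Pr ψ η'
  congr : ∀ {ψ ψ' η}, Pr ψ η → ψ =ᶠ[𝓝 η] ψ' → Pr ψ' η
  add_const : ∀ {ψ η} (g : G), Pr ψ η → Pr (fun x => ψ x + g) η
  sub_const : ∀ {ψ ψ' η}, Pr ψ η → Pr ψ' η → ∀ᶠ η' in 𝓝 η, ψ η' - ψ' η' = ψ η - ψ' η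
  exists_section : ∀ η, ∃ ψ, Pr ψ η
  shift : ∀ {ψ η}, Pr ψ (η + 2 * Real.pi * Complex.I) →
    Pr (fun x => ψ (x + 2 * Real.pi * Complex.I)) η

namespace IsPeriodicTorsor

variable {G : Type*} [AddCommGroup G] {Pr : (ℂ → G) → ℂ → Prop} (h : IsPeriodicTorsor Pr)

/-- The point at parameter `t` of the vertical line through `x`. -/
noncomputable def pt (x t : ℝ) : ℂ := x + t * (2 * Real.pi * Complex.I)

theorem continuous_pt : Continuous fun p : ℝ × ℝ => pt p.1 p.2 := by
  unfold pt; fun_prop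

theorem pt_im (x t : ℝ) : (pt x t).im = t * (2 * Real.pi) := by
  simp [pt]

theorem pt_zero (x : ℝ) : pt x 0 = x := by simp [pt]

theorem pt_one (x : ℝ) : pt x 1 = x + 2 * Real.pi * Complex.I := by simp [pt]

include h

/-- Sections on two adjacent segments are glued along the horizontal line through their common end,
after a translation of the second one. -/
theorem glue {x a b c : ℝ} {ψ₁ ψ₂ : ℂ → G} (hab : a ≤ b) (hbc : b ≤ c)
    (h₁ : ∀ t ∈ Set.Icc a b, Pr ψ₁ (pt x t)) (h₂ : ∀ t ∈ Set.Icc b c, Pr ψ₂ (pt x t)) :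
    ∃ ψ, ∀ t ∈ Set.Icc a c, Pr ψ (pt x t) := by
  classical
  set g := ψ₁ (pt x b) - ψ₂ (pt x b) with hg
  have him : Continuous Complex.im := Complex.continuous_im
  have hpos : 0 < 2 * Real.pi := by positivity
  refine ⟨fun η => if η.im ≤ (pt x b).im then ψ₁ η else ψ₂ η + g, fun t ht => ?_⟩
  rcases lt_trichotomy t b with hlt | rfl | hgt
  · refine h.congr (h₁ t ⟨ht.1, hlt.le⟩) ?_
    have : ∀ᶠ η in 𝓝 (pt x t), η.im < (pt x b).im := him.continuousAt.eventually_lt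
      continuousAt_const (by rw [pt_im, pt_im]; gcongr)
    filter_upwards [this] with η hη
    rw [if_pos hη.le]
  · refine h.congr (h₁ t ⟨ht.1, le_rfl⟩) ?_
    filter_upwards [h.sub_const (h₁ t ⟨ht.1, le_rfl⟩) (h₂ t ⟨le_rfl, ht.2⟩)] with η hη
    split_ifs with hle
    · rfl
    · rw [hg, ← hη]; abel
  · refine h.congr (h.add_const g (h₂ t ⟨hgt.le, ht.2⟩)) ?_
    have : ∀ᶠ η in 𝓝 (pt x t), (pt x b).im < η.im := continuousAt_const.eventually_lt
      him.continuousAt (by rw [pt_im, pt_im]; gcongr)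
    filter_upwards [this] with η hη
    rw [if_neg (not_le.mpr hη)]

theorem exists_section_segment (x a b : ℝ) : ∃ ψ, ∀ t ∈ Set.uIcc a b, Pr ψ (pt x t) := by
  refine isPreconnected_univ.induction₂ (fun a b => ∃ ψ, ∀ t ∈ Set.uIcc a b, Pr ψ (pt x t))
    ?_ ?_ ?_ (Set.mem_univ a) (Set.mem_univ b)
  · intro a _
    obtain ⟨ψ, hψ⟩ := h.exists_section (pt x a)
    have hc : Continuous fun t => pt x t :=
      continuous_pt.comp (by fun_prop : Continuous fun t : ℝ => (x, t))
    have := hc.continuousAt.eventually (h.eventually hψ)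
    obtain ⟨ε, hε, hball⟩ := Metric.eventually_nhds_iff_ball.mp this
    rw [nhdsWithin_univ]
    filter_upwards [Metric.ball_mem_nhds a hε] with b hb
    refine ⟨ψ, fun t ht => hball t ?_⟩
    exact (convex_ball a ε).ordConnected.uIcc_subset (Metric.mem_ball_self hε) hb ht
  · rintro a b c - - - ⟨ψ₁, h₁⟩ ⟨ψ₂, h₂⟩
    by_cases hb : b ∈ Set.uIcc a c
    · rcases le_total a c with hac | hac
      · rw [Set.uIcc_of_le hac] at hb ⊢
        rw [Set.uIcc_of_le hb.1] at h₁
        rw [Set.uIcc_of_le hb.2] at h₂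
        exact h.glue hb.1 hb.2 h₁ h₂
      · rw [Set.uIcc_of_ge hac] at hb ⊢
        rw [Set.uIcc_of_ge hb.2] at h₁
        rw [Set.uIcc_of_ge hb.1] at h₂
        exact h.glue hb.1 hb.2 h₂ h₁
    · by_cases hc : c ∈ Set.uIcc a b
      · exact ⟨ψ₁, fun t ht => h₁ t (Set.uIcc_subset_uIcc_left hc ht)⟩
      · have ha : a ∈ Set.uIcc b c := by
          rw [Set.mem_uIcc] at *
          grind
        exact ⟨ψ₂, fun t ht => h₂ t (Set.uIcc_subset_uIcc_right ha ht)⟩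
  · rintro a b - - ⟨ψ, hψ⟩
    exact ⟨ψ, fun t ht => hψ t (Set.uIcc_comm a b ▸ ht)⟩

theorem monodromy_unique {x : ℝ} {ψ ψ' : ℂ → G} (h₁ : ∀ t ∈ Set.Icc 0 1, Pr ψ (pt x t))
    (h₂ : ∀ t ∈ Set.Icc 0 1, Pr ψ' (pt x t)) :
    ψ (pt x 1) - ψ (pt x 0) = ψ' (pt x 1) - ψ' (pt x 0) := by
  have hc : Continuous fun t => pt x t :=
    continuous_pt.comp (by fun_prop : Continuous fun t : ℝ => (x, t))
  have : ψ (pt x 1) - ψ' (pt x 1) = ψ (pt x 0) - ψ' (pt x 0) :=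
    isPreconnected_Icc.induction₂
      (fun s t => ψ (pt x s) - ψ' (pt x s) = ψ (pt x t) - ψ' (pt x t))
      (fun t ht => by
        have := hc.continuousAt.eventually (h.sub_const (h₁ t ht) (h₂ t ht))
        filter_upwards [nhdsWithin_le_nhds this] with s hs
        exact hs.symm)
      (fun _ _ _ _ _ _ => Eq.trans) (fun _ _ _ _ => Eq.symm)
      (Set.right_mem_Icc.mpr zero_le_one) (Set.left_mem_Icc.mpr zero_le_one)
  rw [sub_eq_sub_iff_add_eq_add] at this ⊢
  rw [this, add_comm]

/-- The monodromy along a vertical segment of length `2π` does not depend on the segment. -/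
theorem monodromy_eq {x y : ℝ} {ψ ψ' : ℂ → G} (h₁ : ∀ t ∈ Set.Icc 0 1, Pr ψ (pt x t))
    (h₂ : ∀ t ∈ Set.Icc 0 1, Pr ψ' (pt y t)) :
    ψ (pt x 1) - ψ (pt x 0) = ψ' (pt y 1) - ψ' (pt y 0) := by
  refine isPreconnected_univ.induction₂ (fun x y => ∀ ψ ψ' : ℂ → G,
    (∀ t ∈ Set.Icc 0 1, Pr ψ (pt x t)) → (∀ t ∈ Set.Icc 0 1, Pr ψ' (pt y t)) →
    ψ (pt x 1) - ψ (pt x 0) = ψ' (pt y 1) - ψ' (pt y 0)) ?_ ?_ ?_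
    (Set.mem_univ x) (Set.mem_univ y) ψ ψ' h₁ h₂
  · intro x _
    rw [nhdsWithin_univ]
    obtain ⟨ψ₀, h₀⟩ := h.exists_section_segment x 0 1
    rw [Set.uIcc_of_le zero_le_one] at h₀
    have htube : ∀ᶠ y in 𝓝 x, ∀ t ∈ Set.Icc (0 : ℝ) 1, Pr ψ₀ (pt y t) := by
      refine isCompact_Icc.eventually_forall_of_forall_eventually fun t ht => ?_
      exact (continuous_pt.continuousAt (x := (x, t))).eventually (h.eventually (h₀ t ht))
    have hshift : Pr (fun η => ψ₀ (η + 2 * Real.pi * Complex.I)) (x : ℂ) := by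
      refine h.shift ?_
      rw [← pt_one]
      exact h₀ 1 (Set.right_mem_Icc.mpr zero_le_one)
    have h00 := h₀ 0 (Set.left_mem_Icc.mpr zero_le_one)
    rw [pt_zero] at h00
    have hloc := Complex.continuous_ofReal.continuousAt.eventually (h.sub_const hshift h00)
    filter_upwards [htube, hloc] with y hy hy' ψ ψ' hψ hψ'
    rw [h.monodromy_unique hψ h₀, h.monodromy_unique hψ' hy, pt_one, pt_one, pt_zero, pt_zero]
    exact hy'.symm
  · intro x y z _ _ _ hxy hyz ψ ψ' hψ hψ'
    obtain ⟨ψ₀, h₀⟩ := h.exists_section_segment y 0 1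
    rw [Set.uIcc_of_le zero_le_one] at h₀
    exact (hxy ψ ψ₀ hψ h₀).trans (hyz ψ₀ ψ' h₀ hψ')
  · intro x y _ _ hxy ψ ψ' hψ hψ'
    exact (hxy ψ' ψ hψ' hψ).symm

end IsPeriodicTorsor

/-! ### Germs in an ideal -/

section IdealGerm

variable {P P' : Type*} [NormedAddCommGroup P] [NormedSpace ℂ P] [NormedAddCommGroup P']
  [NormedSpace ℂ P'] {k : ℕ}

/-- The germ of `H` at `p` is a combination of the functions `φ j` with holomorphic coefficients. -/
def IdealGerm (φ : Fin k → P → ℂ) (H : P → ℂ) (p : P) : Prop :=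
  ∃ a : Fin k → P → ℂ, (∀ j, AnalyticAt ℂ (a j) p) ∧ H =ᶠ[𝓝 p] fun q => ∑ j, φ j q * a j q

namespace IdealGerm

variable {φ : Fin k → P → ℂ} {H H' : P → ℂ} {p : P}

theorem zero : IdealGerm φ (fun _ => 0) p :=
  ⟨fun _ _ => 0, fun _ => analyticAt_const, by simp⟩

theorem congr (h : IdealGerm φ H p) (he : H' =ᶠ[𝓝 p] H) : IdealGerm φ H' p := by
  obtain ⟨a, ha, haH⟩ := h
  exact ⟨a, ha, he.trans haH⟩

theorem add (h : IdealGerm φ H p) (h' : IdealGerm φ H' p) :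
    IdealGerm φ (fun q => H q + H' q) p := by
  obtain ⟨a, ha, haH⟩ := h
  obtain ⟨a', ha', haH'⟩ := h'
  refine ⟨fun j q => a j q + a' j q, fun j => (ha j).add (ha' j), ?_⟩
  filter_upwards [haH, haH'] with q h1 h2
  rw [h1, h2, ← Finset.sum_add_distrib]
  exact Finset.sum_congr rfl fun j _ => (mul_add _ _ _).symm

theorem mul_left (h : IdealGerm φ H p) {u : P → ℂ} (hu : AnalyticAt ℂ u p) :
    IdealGerm φ (fun q => u q * H q) p := by
  obtain ⟨a, ha, haH⟩ := h
  refine ⟨fun j q => u q * a j q, fun j => hu.mul (ha j), ?_⟩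
  filter_upwards [haH] with q h1
  rw [h1, Finset.mul_sum]
  exact Finset.sum_congr rfl fun j _ => by ring

theorem neg (h : IdealGerm φ H p) : IdealGerm φ (fun q => -H q) p := by
  simpa using h.mul_left (u := fun _ => -1) analyticAt_const

theorem sub (h : IdealGerm φ H p) (h' : IdealGerm φ H' p) :
    IdealGerm φ (fun q => H q - H' q) p := by
  simpa [sub_eq_add_neg] using h.add h'.neg

theorem eventually (h : IdealGerm φ H p) : ∀ᶠ q in 𝓝 p, IdealGerm φ H q := by
  obtain ⟨a, ha, haH⟩ := h
  filter_upwards [haH.eventually_nhds,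
    Filter.eventually_all.mpr fun j => (ha j).eventually_analyticAt] with q h1 h2
  exact ⟨a, h2, h1⟩

theorem comp {θ : P' → P} {p' : P'} (h : IdealGerm φ H (θ p')) (hθ : AnalyticAt ℂ θ p') :
    IdealGerm (fun j q => φ j (θ q)) (fun q => H (θ q)) p' := by
  obtain ⟨a, ha, haH⟩ := h
  refine ⟨fun j q => a j (θ q), fun j => (ha j).comp hθ, ?_⟩
  exact hθ.continuousAt.eventually haH

end IdealGerm

end IdealGerm

/-! ### Liouville's theorem modulo an ideal -/

section Liouville

variable {V : Type*} [NormedAddCommGroup V] [NormedSpace ℂ V] {k : ℕ}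

/-- An analytic function whose derivative in the last variable lies in the ideal generated by
functions of the first variable is locally constant in the last variable modulo that ideal. -/
theorem IdealGerm.eventually_sub_const {f : Fin k → V → ℂ} {A A' : V × ℂ → ℂ} {b : V} {c : ℂ}
    (hA : ∀ᶠ p : V × ℂ in 𝓝 (b, c), HasDerivAt (fun η => A (p.1, η)) (A' p) p.2)
    (hA' : IdealGerm (fun j q => f j q.1) A' (b, c)) :
    ∀ᶠ η in 𝓝 c, IdealGerm f (fun w => A (w, η) - A (w, c)) b := by
  obtain ⟨a, ha, haA⟩ := hA'
  choose B hB hBa using fun j => (ha j).exists_primitive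
  obtain ⟨ε, hε, hball⟩ := Metric.eventually_nhds_iff_ball.mp ((hA.and haA).and
    ((Filter.eventually_all.mpr hBa).and
      (Filter.eventually_all.mpr fun j => (hB j).eventually_analyticAt)))
  rw [← ball_prod_same] at hball
  filter_upwards [Metric.ball_mem_nhds c hε] with η hη
  refine ⟨fun j w => B j (w, η) - B j (w, c), fun j => ?_, ?_⟩
  · have h1 := (hball (b, η) ⟨Metric.mem_ball_self hε, hη⟩).2.2 j
    have h2 := (hball (b, c) ⟨Metric.mem_ball_self hε, Metric.mem_ball_self hε⟩).2.2 j
    exact (h1.comp (f := fun w => (w, η)) (analyticAt_id.prod analyticAt_const)).sub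
      (h2.comp (f := fun w => (w, c)) (analyticAt_id.prod analyticAt_const))
  · filter_upwards [Metric.ball_mem_nhds b hε] with w hw
    have hderiv : ∀ z ∈ Metric.ball c ε,
        HasDerivAt (fun z => A (w, z) - ∑ j, f j w * B j (w, z)) 0 z := by
      intro z hz
      obtain ⟨⟨h1, h2⟩, h3, -⟩ := hball (w, z) ⟨hw, hz⟩
      have h4 := h1.sub (HasDerivAt.fun_sum (u := Finset.univ)
        fun j _ => (h3 j).const_mul (f j w))
      rw [h2, sub_self] at h4
      exact h4
    have hconst := (convex_ball c ε).norm_image_sub_le_of_norm_hasDerivWithin_le (C := 0)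
      (fun z hz => (hderiv z hz).hasDerivWithinAt) (fun z _ => by simp)
      (Metric.mem_ball_self hε) hη
    rw [zero_mul, norm_le_zero_iff, sub_eq_zero] at hconst
    simp only [mul_sub, Finset.sum_sub_distrib]
    linear_combination hconst

/-- The functions whose germ at `b` lies in the ideal generated by the `f j`. -/
def idealGermSubgroup (f : Fin k → V → ℂ) (b : V) : AddSubgroup (V → ℂ) where
  carrier := {H | IdealGerm f H b}
  add_mem' h h' := h.add h'
  zero_mem' := IdealGerm.zero
  neg_mem' h := h.neg

/-- Functions modulo functions whose germ lies in an ideal. -/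
abbrev ModIdeal (f : Fin k → V → ℂ) (b : V) : Type _ := (V → ℂ) ⧸ idealGermSubgroup f b

/-- The class of a function. -/
def ModIdeal.mk (f : Fin k → V → ℂ) (b : V) (H : V → ℂ) : ModIdeal f b := QuotientAddGroup.mk H

theorem ModIdeal.mk_eq_iff {f : Fin k → V → ℂ} {b : V} {H H' : V → ℂ} :
    ModIdeal.mk f b H = ModIdeal.mk f b H' ↔ IdealGerm f (fun w => H w - H' w) b := by
  rw [eq_comm, ModIdeal.mk, ModIdeal.mk, QuotientAddGroup.eq, neg_add_eq_sub]
  rfl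

theorem ModIdeal.mk_sub {f : Fin k → V → ℂ} {b : V} {H H' : V → ℂ} :
    ModIdeal.mk f b H - ModIdeal.mk f b H' = ModIdeal.mk f b (fun w => H w - H' w) := rfl

/-- `ψ` is near `η` a primitive, modulo the ideal generated by the `f j` and up to a constant, of
the function `F (exp ξ) (w, exp ξ)` of `ξ`. -/
def IsPrimitiveMod (f : Fin k → V → ℂ) (b : V) (F : ℂ → V × ℂ → ℂ) (ψ : ℂ → ModIdeal f b)
    (η : ℂ) : Prop :=
  ∃ A A' : V × ℂ → ℂ, AnalyticAt ℂ A (b, η) ∧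
    (∀ᶠ p : V × ℂ in 𝓝 (b, η), HasDerivAt (fun ξ => A (p.1, ξ)) (A' p) p.2) ∧
    IdealGerm (fun j q => f j q.1)
      (fun q => A' q - F (Complex.exp η) (q.1, Complex.exp q.2)) (b, η) ∧
    ∃ g, ∀ᶠ ξ in 𝓝 η, ψ ξ = ModIdeal.mk f b (fun w => A (w, ξ)) + g

theorem analyticAt_prod_cexp (b : V) (η : ℂ) :
    AnalyticAt ℂ (fun q : V × ℂ => (q.1, Complex.exp q.2)) (b, η) :=
  analyticAt_fst.prod analyticAt_snd.cexp

/-- Primitives exist locally and are unique up to constants, by `IdealGerm.eventually_sub_const`. -/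
theorem isPeriodicTorsor_isPrimitiveMod (f : Fin k → V → ℂ) (b : V) (F : ℂ → V × ℂ → ℂ)
    (hF : ∀ τ, AnalyticAt ℂ (F τ) (b, τ))
    (hFF : ∀ τ, ∀ᶠ η in 𝓝 τ, IdealGerm (fun j q => f j q.1) (fun q => F η q - F τ q) (b, η)) :
    IsPeriodicTorsor (IsPrimitiveMod f b F) where
  eventually := by
    rintro ψ η ⟨A, A', hA, hAA', hI, g, hg⟩
    have hc : Filter.Tendsto (fun η : ℂ => (b, η)) (𝓝 η) (𝓝 (b, η)) :=
      (by fun_prop : Continuous fun η : ℂ => (b, η)).tendsto η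
    have hexp := Complex.continuous_exp.continuousAt.eventually (hFF (Complex.exp η))
    filter_upwards [hc.eventually hA.eventually_analyticAt, hc.eventually hAA'.eventually_nhds,
      hc.eventually hI.eventually, hg.eventually_nhds, hexp] with η' h1 h2 h3 h4 h5
    refine ⟨A, A', h1, h2, ?_, g, h4⟩
    have h6 := IdealGerm.comp (θ := fun q : V × ℂ => (q.1, Complex.exp q.2)) (p' := (b, η')) h5
      (analyticAt_prod_cexp b η')
    refine (h3.sub h6).congr (Filter.Eventually.of_forall fun q => ?_)
    simp
  congr := by
    rintro ψ ψ' η ⟨A, A', hA, hAA', hI, g, hg⟩ h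
    exact ⟨A, A', hA, hAA', hI, g, (h.symm.and hg).mono fun ξ hξ => hξ.1.trans hξ.2⟩
  add_const := by
    rintro ψ η g' ⟨A, A', hA, hAA', hI, g, hg⟩
    exact ⟨A, A', hA, hAA', hI, g + g', 
      hg.mono fun ξ hξ => (congrArg (· + g') hξ).trans (add_assoc _ _ _)⟩
  sub_const := by
    rintro ψ ψ₂ η ⟨A, A', hA, hAA', hI, g, hg⟩ ⟨A₂, A₂', hA₂, hAA₂', hI₂, g₂, hg₂⟩
    have h1 : ∀ᶠ p : V × ℂ in 𝓝 (b, η),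
        HasDerivAt (fun ξ => A (p.1, ξ) - A₂ (p.1, ξ)) (A' p - A₂' p) p.2 :=
      (hAA'.and hAA₂').mono fun p hp => hp.1.sub hp.2
    have h2 : IdealGerm (fun j q => f j q.1) (fun p => A' p - A₂' p) (b, η) :=
      (hI.sub hI₂).congr (Filter.Eventually.of_forall fun q => by simp)
    filter_upwards [IdealGerm.eventually_sub_const (A := fun p => A p - A₂ p) h1 h2, hg, hg₂]
      with ξ h3 h4 h5
    rw [h4, h5, hg.self_of_nhds, hg₂.self_of_nhds]
    have h6 : ModIdeal.mk f b (fun w => A (w, ξ)) - ModIdeal.mk f b (fun w => A₂ (w, ξ)) =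
        ModIdeal.mk f b (fun w => A (w, η)) - ModIdeal.mk f b (fun w => A₂ (w, η)) := by
      rw [ModIdeal.mk_sub, ModIdeal.mk_sub, ModIdeal.mk_eq_iff]
      exact h3
    rw [add_sub_add_comm, h6, add_sub_add_comm]
  exists_section := by
    intro η
    have h1 : AnalyticAt ℂ (fun q : V × ℂ => F (Complex.exp η) (q.1, Complex.exp q.2)) (b, η) :=
      AnalyticAt.fun_comp (g := F (Complex.exp η)) (hF _) (analyticAt_prod_cexp b η)
    obtain ⟨B, hB, hB'⟩ := h1.exists_primitive
    refine ⟨fun ξ => ModIdeal.mk f b (fun w => B (w, ξ)), B, _, hB, hB', ?_, 0, ?_⟩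
    · exact IdealGerm.zero.congr (Filter.Eventually.of_forall fun q => sub_self _)
    · exact Filter.Eventually.of_forall fun ξ => (add_zero _).symm
  shift := by
    rintro ψ η ⟨A, A', hA, hAA', hI, g, hg⟩
    have hθ : AnalyticAt ℂ (fun q : V × ℂ => (q.1, q.2 + 2 * Real.pi * Complex.I)) (b, η) :=
      analyticAt_fst.prod (analyticAt_snd.add analyticAt_const)
    refine ⟨fun q => A (q.1, q.2 + 2 * Real.pi * Complex.I),
      fun q => A' (q.1, q.2 + 2 * Real.pi * Complex.I), AnalyticAt.fun_comp hA hθ, ?_, ?_, g, ?_⟩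
    · have h1 := hθ.continuousAt.eventually hAA'
      filter_upwards [h1] with p hp
      exact hp.comp_add_const
    · refine (IdealGerm.comp (p' := (b, η)) hI hθ).congr (Filter.Eventually.of_forall fun q => ?_)
      simp only [Complex.exp_add, Complex.exp_two_pi_mul_I, mul_one]
    · have h2 : Continuous fun x : ℂ => x + 2 * Real.pi * Complex.I := by fun_prop
      exact h2.continuousAt.eventually hg

/-- A family of holomorphic functions `F τ` near `(b, τ)`, for `τ ∈ ℂ`, which coincide modulo the
ideal generated by functions `f j` on the base and have at infinity a pole of order at most `r`
modulo this ideal, is a polynomial modulo the ideal. Only its consequence for the value at `0` is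
stated: this value is the `r`-th coefficient of the expansion at infinity.

The two sides are, up to the factor `2πi`, the periods of the primitives of `F (exp ξ)` in the
regions `Re ξ ≪ 0` and `Re ξ ≫ 0`. -/
theorem IdealGerm.liouville {f : Fin k → V → ℂ} {b : V} {F : ℂ → V × ℂ → ℂ}
    (hF : ∀ τ, AnalyticAt ℂ (F τ) (b, τ))
    (hFF : ∀ τ, ∀ᶠ η in 𝓝 τ, IdealGerm (fun j q => f j q.1) (fun q => F η q - F τ q) (b, η))
    {r : ℕ} {c : ℕ → V → ℂ} {K : V × ℂ → ℂ} (hc : ∀ m, AnalyticAt ℂ (c m) b)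
    (hK : AnalyticAt ℂ K (b, 0)) {F' : V × ℂ → ℂ}
    (hF' : ∀ᶠ p : V × ℂ in 𝓝 (b, 0), F' p =
      (∑ m ∈ Finset.range r, c m p.1 * p.2 ^ m) + c r p.1 * p.2 ^ r + K p * p.2 ^ (r + 1))
    (hFF' : ∀ᶠ τ in Bornology.cobounded ℂ,
      IdealGerm (fun j q => f j q.1) (fun q => F τ q - q.2 ^ r * F' (q.1, q.2⁻¹)) (b, τ)) :
    IdealGerm f (fun w => F 0 (w, 0) - c r w) b := by
  have htor := isPeriodicTorsor_isPrimitiveMod f b F hF hFF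
  have hnorm : ∀ (x t : ℝ), ‖Complex.exp (IsPeriodicTorsor.pt x t)‖ = Real.exp x := by
    intro x t
    rw [Complex.norm_exp]
    simp [IsPeriodicTorsor.pt]
  -- the primitive near `0`
  obtain ⟨K₀, hK₀, hFK₀⟩ : ∃ K₀ : V × ℂ → ℂ, AnalyticAt ℂ K₀ (b, 0) ∧
      ∀ᶠ p : V × ℂ in 𝓝 (b, 0), F 0 p = F 0 (p.1, 0) + p.2 * K₀ p := by
    have h1 : AnalyticAt ℂ (fun q : V × (Unit → ℂ) => F 0 (q.1, q.2 ())) (b, 0) :=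
      AnalyticAt.fun_comp (g := F 0) (hF 0) (f := fun q : V × (Unit → ℂ) => (q.1, q.2 ()))
        (analyticAt_fst.prod (analyticAt_pi_iff.mp analyticAt_snd ()))
    obtain ⟨K₁, hK₁, hH⟩ := h1.exists_hadamard
    have hθ : AnalyticAt ℂ (fun q : V × ℂ => ((q.1, fun _ => q.2) : V × (Unit → ℂ))) (b, 0) :=
      analyticAt_fst.prod (analyticAt_pi_iff.mpr fun _ => analyticAt_snd)
    refine ⟨fun q => K₁ () (q.1, fun _ => q.2), AnalyticAt.fun_comp (g := K₁ ()) (hK₁ ()) hθ, ?_⟩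
    filter_upwards [hθ.continuousAt.eventually hH] with p hp
    simpa using hp
  obtain ⟨B₀, hB₀, hBK₀⟩ := hK₀.exists_primitive
  have hF00 : AnalyticAt ℂ (fun w => F 0 (w, 0)) b :=
    AnalyticAt.fun_comp (g := F 0) (hF 0) (f := fun w => (w, (0 : ℂ)))
      (analyticAt_id.prod analyticAt_const)
  obtain ⟨ε₀, hε₀, hball₀⟩ := Metric.eventually_nhds_iff_ball.mp
    (((by fun_prop : Continuous fun η : ℂ => (b, η)).tendsto 0).eventually
      (hB₀.eventually_analyticAt.and (hFK₀.eventually_nhds.and hBK₀.eventually_nhds)) |>.and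
        (hFF 0))
  let ψ₀ : ℂ → ModIdeal f b := fun η =>
    ModIdeal.mk f b fun w => η * F 0 (w, 0) + B₀ (w, Complex.exp η)
  have hψ₀ : ∀ η, ‖Complex.exp η‖ < ε₀ → IsPrimitiveMod f b F ψ₀ η := by
    intro η hη
    obtain ⟨⟨h1, h2, h3⟩, h4⟩ := hball₀ (Complex.exp η) (mem_ball_zero_iff.mpr hη)
    have hθ := analyticAt_prod_cexp b η
    refine ⟨fun q => q.2 * F 0 (q.1, 0) + B₀ (q.1, Complex.exp q.2),
      fun q => F 0 (q.1, 0) + K₀ (q.1, Complex.exp q.2) * Complex.exp q.2, ?_, ?_, ?_, 0, ?_⟩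
    · exact (analyticAt_snd.mul
        (AnalyticAt.fun_comp (g := fun w => F 0 (w, 0)) hF00 analyticAt_fst)).add
        (AnalyticAt.fun_comp (g := B₀) h1 hθ)
    · filter_upwards [hθ.continuousAt.eventually h3] with p hp
      have h5 := (hasDerivAt_id p.2).mul_const (F 0 (p.1, 0))
      have h6 := HasDerivAt.comp p.2 hp (Complex.hasDerivAt_exp p.2)
      rw [one_mul] at h5
      exact h5.add h6
    · refine (IdealGerm.comp (p' := (b, η)) h4 hθ).neg.congr ?_
      filter_upwards [hθ.continuousAt.eventually h2] with p hp
      rw [hp]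
      ring
    · exact Filter.Eventually.of_forall fun ξ => (add_zero _).symm
  -- the primitive near infinity
  obtain ⟨B, hB, hBK⟩ := hK.exists_primitive
  obtain ⟨ε₁, hε₁, hball₁⟩ := Metric.eventually_nhds_iff_ball.mp
    (((by fun_prop : Continuous fun η : ℂ => (b, η)).tendsto 0).eventually
      (hB.eventually_analyticAt.and (hF'.eventually_nhds.and hBK.eventually_nhds)))
  obtain ⟨R, -, hR⟩ := (Filter.hasBasis_cobounded_norm (E := ℂ)).eventually_iff.mp hFF'
  let ψ₁ : ℂ → ModIdeal f b := fun η => ModIdeal.mk f b fun w =>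
    (∑ m ∈ Finset.range r, c m w * (Complex.exp (((r - m : ℕ) : ℂ) * η) / ((r - m : ℕ) : ℂ))) +
      c r w * η - B (w, Complex.exp (-η))
  have hψ₁ : ∀ η, R ≤ ‖Complex.exp η‖ → ‖Complex.exp (-η)‖ < ε₁ → IsPrimitiveMod f b F ψ₁ η := by
    intro η hη hη'
    obtain ⟨h1, h2, h3⟩ := hball₁ (Complex.exp (-η)) (mem_ball_zero_iff.mpr hη')
    have h4 := hR (x := Complex.exp η) hη
    have hθ : AnalyticAt ℂ (fun q : V × ℂ => (q.1, Complex.exp (-q.2))) (b, η) :=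
      analyticAt_fst.prod analyticAt_snd.neg.cexp
    have hcm : ∀ m, AnalyticAt ℂ (fun q : V × ℂ => c m q.1) (b, η) := fun m =>
      AnalyticAt.fun_comp (g := c m) (hc m) analyticAt_fst
    refine ⟨fun q => (∑ m ∈ Finset.range r,
        c m q.1 * (Complex.exp (((r - m : ℕ) : ℂ) * q.2) / ((r - m : ℕ) : ℂ))) +
        c r q.1 * q.2 - B (q.1, Complex.exp (-q.2)),
      fun q => (∑ m ∈ Finset.range r, c m q.1 * Complex.exp (((r - m : ℕ) : ℂ) * q.2)) + c r q.1 +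
        K (q.1, Complex.exp (-q.2)) * Complex.exp (-q.2), ?_, ?_, ?_, 0, ?_⟩
    · refine ((Finset.analyticAt_fun_sum _ fun m _ => ?_).add ((hcm r).mul analyticAt_snd)).sub
        (AnalyticAt.fun_comp (g := B) h1 hθ)
      exact (hcm m).mul ((analyticAt_const.mul analyticAt_snd).cexp.div_const)
    · filter_upwards [hθ.continuousAt.eventually h3] with p hp
      have h5 : ∀ m ∈ Finset.range r, HasDerivAt
          (fun ξ => c m p.1 * (Complex.exp (((r - m : ℕ) : ℂ) * ξ) / ((r - m : ℕ) : ℂ)))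
          (c m p.1 * Complex.exp (((r - m : ℕ) : ℂ) * p.2)) p.2 := by
        intro m hm
        have hne : ((r - m : ℕ) : ℂ) ≠ 0 :=
          Nat.cast_ne_zero.mpr (Nat.sub_ne_zero_of_lt (Finset.mem_range.mp hm))
        have h6 := ((((hasDerivAt_id p.2).const_mul ((r - m : ℕ) : ℂ)).cexp).div_const
          ((r - m : ℕ) : ℂ)).const_mul (c m p.1)
        refine h6.congr_deriv ?_
        rw [id_eq, mul_one, mul_div_assoc, div_self hne, mul_one]
      have h7 := (hasDerivAt_id p.2).const_mul (c r p.1)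
      have h8 := HasDerivAt.comp p.2 hp ((hasDerivAt_id p.2).neg.cexp)
      have h9 := ((HasDerivAt.fun_sum h5).add h7).sub h8
      refine h9.congr_deriv ?_
      simp only [mul_one, mul_neg, sub_neg_eq_add]
      rfl
    · refine (IdealGerm.comp (p' := (b, η)) h4 (analyticAt_prod_cexp b η)).neg.congr ?_
      filter_upwards [hθ.continuousAt.eventually h2] with p hp
      have hexp : (Complex.exp p.2)⁻¹ = Complex.exp (-p.2) := (Complex.exp_neg _).symm
      have he : Complex.exp p.2 * Complex.exp (-p.2) = 1 := by
        rw [← Complex.exp_add, add_neg_cancel, Complex.exp_zero]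
      have h10 : Complex.exp p.2 ^ r * F' (p.1, Complex.exp (-p.2)) =
          (∑ m ∈ Finset.range r, c m p.1 * Complex.exp (((r - m : ℕ) : ℂ) * p.2)) + c r p.1 +
            K (p.1, Complex.exp (-p.2)) * Complex.exp (-p.2) := by
        rw [hp, mul_add, mul_add, Finset.mul_sum]
        congr 1
        · congr 1
          · refine Finset.sum_congr rfl fun m hm => ?_
            have hsplit : r = (r - m) + m := (Nat.sub_add_cancel (Finset.mem_range.mp hm).le).symm
            rw [Complex.exp_nat_mul]
            conv_lhs => rw [hsplit]
            rw [pow_add]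
            calc _ = c m p.1 * Complex.exp p.2 ^ (r - m) *
                  (Complex.exp p.2 * Complex.exp (-p.2)) ^ m := by rw [mul_pow]; ring
              _ = _ := by rw [he, one_pow, mul_one]
          · calc _ = c r p.1 * (Complex.exp p.2 * Complex.exp (-p.2)) ^ r := by rw [mul_pow]; ring
              _ = _ := by rw [he, one_pow, mul_one]
        · calc _ = K (p.1, Complex.exp (-p.2)) * Complex.exp (-p.2) *
                (Complex.exp p.2 * Complex.exp (-p.2)) ^ r := by rw [mul_pow]; ring
            _ = _ := by rw [he, one_pow, mul_one]
      rw [← h10, hexp]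
      ring
    · exact Filter.Eventually.of_forall fun ξ => (add_zero _).symm
  -- comparison of the periods
  obtain ⟨x, hx⟩ : ∃ x : ℝ, Real.exp x < ε₀ :=
    (Real.tendsto_exp_atBot.eventually_lt_const hε₀).exists
  obtain ⟨y, hy, hy'⟩ : ∃ y : ℝ, R ≤ Real.exp y ∧ Real.exp (-y) < ε₁ :=
    ((Real.tendsto_exp_atTop.eventually_ge_atTop R).and
      (Real.tendsto_exp_neg_atTop_nhds_zero.eventually_lt_const hε₁)).exists
  have hmon := htor.monodromy_eq (x := x) (y := y) (ψ := ψ₀) (ψ' := ψ₁)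
    (fun t _ => hψ₀ _ (by rwa [hnorm])) (fun t _ => hψ₁ _ (by rwa [hnorm]) (by
      rw [Complex.exp_neg, norm_inv, hnorm, ← Real.exp_neg]
      exact hy'))
  have hper : ∀ (n : ℕ) (η : ℂ), Complex.exp ((n : ℂ) * (η + 2 * Real.pi * Complex.I)) =
      Complex.exp ((n : ℂ) * η) := by
    intro n η
    rw [Complex.exp_nat_mul, Complex.exp_add, Complex.exp_two_pi_mul_I, mul_one,
      Complex.exp_nat_mul]
  have hper' : ∀ η : ℂ, Complex.exp (-(η + 2 * Real.pi * Complex.I)) = Complex.exp (-η) := by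
    intro η
    rw [Complex.exp_neg, Complex.exp_add, Complex.exp_two_pi_mul_I, mul_one, Complex.exp_neg]
  have hpi : (2 * Real.pi * Complex.I : ℂ) ≠ 0 := Complex.two_pi_I_ne_zero
  simp only [ψ₀, ψ₁, IsPeriodicTorsor.pt_one, IsPeriodicTorsor.pt_zero, ModIdeal.mk_sub,
    ModIdeal.mk_eq_iff, hper, hper', Complex.exp_add, Complex.exp_two_pi_mul_I, mul_one] at hmon
  refine (hmon.mul_left (u := fun _ => (2 * Real.pi * Complex.I : ℂ)⁻¹) analyticAt_const).congr
    (Filter.Eventually.of_forall fun w => ?_)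
  dsimp only
  rw [eq_inv_mul_iff_mul_eq₀ hpi]
  ring

end Liouville

namespace CplxGeom

/-! ### Germs of functions on a local model -/

section AnalyticSubring

variable {V : Type} [NormedAddCommGroup V] [NormedSpace ℂ V]

/-- The ring of functions that are holomorphic near `z`. -/
def analyticSubring (z : V) : Subring (V → ℂ) where
  carrier := {F | AnalyticAt ℂ F z}
  mul_mem' := AnalyticAt.mul
  one_mem' := analyticAt_const
  add_mem' := AnalyticAt.add
  zero_mem' := analyticAt_const
  neg_mem' := AnalyticAt.neg

/-- Passage from functions that are holomorphic near `z` to their germs. -/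
def analyticSubring.toHolGerm (z : V) : analyticSubring z →+* HolGerm z where
  toFun F := HolGerm.mk F.1 F.2
  map_one' := rfl
  map_mul' _ _ := rfl
  map_zero' := rfl
  map_add' _ _ := rfl

theorem HolGerm.exists_mk {z : V} (g : HolGerm z) : ∃ F hF, g = HolGerm.mk F hF := by
  obtain ⟨_, F, hF, rfl⟩ := g
  exact ⟨F, hF, rfl⟩

theorem HolGerm.mk_eq_mk_iff {z : V} {F G : V → ℂ} {hF : AnalyticAt ℂ F z}
    {hG : AnalyticAt ℂ G z} : HolGerm.mk F hF = HolGerm.mk G hG ↔ F =ᶠ[𝓝 z] G :=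
  Subtype.ext_iff.trans Filter.Germ.coe_eq

theorem HolGerm.mk_sub_mem_span_iff {k : ℕ} {z : V} {F G : V → ℂ} {hF : AnalyticAt ℂ F z}
    {hG : AnalyticAt ℂ G z} {f : Fin k → V → ℂ} {hf : ∀ j, AnalyticAt ℂ (f j) z} :
    HolGerm.mk F hF - HolGerm.mk G hG ∈ Ideal.span (Set.range fun j => HolGerm.mk (f j) (hf j)) ↔
      IdealGerm f (fun w => F w - G w) z := by
  have hsum : ∀ (a : Fin k → V → ℂ) (ha : ∀ j, AnalyticAt ℂ (a j) z),
      ∑ j, HolGerm.mk (a j) (ha j) * HolGerm.mk (f j) (hf j) = HolGerm.mk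
        (fun w => ∑ j, f j w * a j w)
        (Finset.analyticAt_fun_sum _ fun j _ => (hf j).mul (ha j)) := by
    intro a ha
    have h1 := map_sum (analyticSubring.toHolGerm z)
      (fun j => (⟨f j * a j, (hf j).mul (ha j)⟩ : analyticSubring z)) Finset.univ
    refine Eq.trans (Finset.sum_congr rfl fun j _ => mul_comm _ _) (h1.symm.trans ?_)
    refine (HolGerm.mk_eq_mk_iff (hF := Subtype.prop
      (∑ j, (⟨f j * a j, (hf j).mul (ha j)⟩ : analyticSubring z)))).mpr
      (Filter.Eventually.of_forall fun w => ?_)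
    simp
  rw [Ideal.mem_span_range_iff_exists_fun]
  constructor
  · rintro ⟨c, hc⟩
    choose a ha hca using fun j => HolGerm.exists_mk (c j)
    refine ⟨a, ha, ?_⟩
    simp only [hca, hsum] at hc
    exact (HolGerm.mk_eq_mk_iff (hF := hF.sub hG).mp hc.symm)
  · rintro ⟨a, ha, h⟩
    refine ⟨fun j => HolGerm.mk (a j) (ha j), ?_⟩
    rw [hsum]
    exact HolGerm.mk_eq_mk_iff (hG := hF.sub hG).mpr h.symm

/-- The value of a germ. -/
def HolGerm.value (z : V) : HolGerm z →+* ℂ :=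
  Filter.Germ.valueRingHom.comp (HolGerm z).subtype

theorem HolGerm.value_mk {z : V} {F : V → ℂ} (hF : AnalyticAt ℂ F z) :
    HolGerm.value z (HolGerm.mk F hF) = F z := rfl

theorem HolGerm.isUnit_of_value_ne_zero {z : V} {g : HolGerm z} (h : HolGerm.value z g ≠ 0) :
    IsUnit g := by
  obtain ⟨F, hF, rfl⟩ := HolGerm.exists_mk g
  rw [HolGerm.value_mk] at h
  refine IsUnit.of_mul_eq_one (HolGerm.mk (fun w => (F w)⁻¹) (hF.fun_inv h)) ?_
  refine HolGerm.mk_eq_mk_iff (hF := hF.mul (hF.fun_inv h)) (hG := analyticAt_const).mpr ?_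
  filter_upwards [hF.continuousAt.eventually_ne h] with w hw
  exact mul_inv_cancel₀ hw

end AnalyticSubring

namespace LocalModel

variable {X : ComplexSpace.{u}} (c : X.Model)

theorem f_eq_zero (y : c.U) (j : Fin c.k) : c.f j (c.φ y) = 0 :=
  (c.range_φ.subset (Set.mem_range_self y)).2 j

theorem pull_mk_eq_pull_mk_iff (y : c.U) {F G : (Fin c.n → ℂ) → ℂ} (hF : AnalyticAt ℂ F (c.φ y))
    (hG : AnalyticAt ℂ G (c.φ y)) :
    c.pull y (HolGerm.mk F hF) = c.pull y (HolGerm.mk G hG) ↔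
      IdealGerm c.f (fun w => F w - G w) (c.φ y) := by
  rw [← sub_eq_zero, ← map_sub, ← RingHom.mem_ker, c.ker_pull]
  exact HolGerm.mk_sub_mem_span_iff

/-- The value at `y` of a germ of a function on `X`. -/
noncomputable def eval (y : c.U) : X.Stalk y.1 →+* ℂ :=
  RingHom.liftOfSurjective (c.pull y) (c.surjective_pull y) ⟨HolGerm.value (c.φ y), by
    rw [c.ker_pull, Ideal.span_le]
    rintro _ ⟨j, rfl⟩
    exact c.f_eq_zero y j⟩

theorem eval_pull (y : c.U) (g : HolGerm (c.φ y)) : c.eval y (c.pull y g) = HolGerm.value _ g :=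
  RingHom.liftOfRightInverse_comp_apply _ _ _ _ _

theorem eval_constGerm (y : c.U) (a : ℂ) : c.eval y (X.constGerm y.1 a) = a := by
  have h : X.constGerm y.1 a = c.pull y (HolGerm.mk (fun _ => a) analyticAt_const) :=
    (c.pull_const y a).symm
  rw [h, eval_pull, HolGerm.value_mk]

theorem isUnit_iff_eval_ne_zero (y : c.U) (t : X.Stalk y.1) : IsUnit t ↔ c.eval y t ≠ 0 := by
  refine ⟨fun h => (h.map (c.eval y)).ne_zero, fun h => ?_⟩
  obtain ⟨g, rfl⟩ := c.surjective_pull y t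
  rw [eval_pull] at h
  exact (HolGerm.isUnit_of_value_ne_zero h).map (c.pull y)

theorem exists_eq_pullVec {J : Type} [Fintype J] (y : c.U) (ζ : J → X.Stalk y.1) :
    ∃ (Z : (Fin c.n → ℂ) → J → ℂ) (hZ : AnalyticAt ℂ Z (c.φ y)), ζ = c.pullVec y Z hZ ∧
      ∀ a, Z (c.φ y) a = c.eval y (ζ a) := by
  choose g hg using fun a => c.surjective_pull y (ζ a)
  choose Z hZ hgZ using fun a => HolGerm.exists_mk (g a)
  refine ⟨fun w a => Z a w, analyticAt_pi_iff.mpr hZ, funext fun a => ?_, fun a => ?_⟩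
  · rw [← hg, hgZ]
    rfl
  · rw [← hg, hgZ, eval_pull, HolGerm.value_mk]

section

variable {J : Type} [Fintype J]

theorem mk_eq_mk_prodStalk_iff (y : c.U) (z : J → ℂ) {F G : (Fin c.n → ℂ) × (J → ℂ) → ℂ}
    (hF : AnalyticAt ℂ F (c.φ y, z)) (hG : AnalyticAt ℂ G (c.φ y, z)) :
    (Ideal.Quotient.mk _ (HolGerm.mk F hF) : c.ProdStalk y z) =
      Ideal.Quotient.mk _ (HolGerm.mk G hG) ↔
      IdealGerm (fun j p => c.f j p.1) (fun p => F p - G p) (c.φ y, z) := by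
  rw [Ideal.Quotient.eq]
  exact HolGerm.mk_sub_mem_span_iff

end

theorem eventually_of_eventually_φ {x : c.U} {P : c.U → Prop} (h : ∀ᶠ y in 𝓝 x, P y) :
    ∃ ε > 0, ∀ y : c.U, c.φ y ∈ Metric.ball (c.φ x) ε → P y := by
  rw [c.isEmbedding_φ.isInducing.nhds_eq_comap, Filter.eventually_comap] at h
  obtain ⟨ε, hε, hball⟩ := Metric.eventually_nhds_iff_ball.mp h
  exact ⟨ε, hε, fun y hy => hball _ hy y rfl⟩

end LocalModel

end CplxGeom

namespace CplxGeom

open TensorWord Matrix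

/-! ### Sections of `𝒪(r)` are given by symmetric tensors -/

namespace LocalModel

variable {X : ComplexSpace.{u}} (c : X.Model)

theorem pull_sum_mul_prod {J : Type} [Fintype J] {I : Type*} [Fintype I] [DecidableEq I]
    (y : c.U) {A : (I → J) → (Fin c.n → ℂ) → ℂ} (hA : ∀ α, AnalyticAt ℂ (A α) (c.φ y))
    {Z : (Fin c.n → ℂ) → J → ℂ} (hZ : AnalyticAt ℂ Z (c.φ y))
    (h : AnalyticAt ℂ (fun w => ∑ α, A α w * ∏ l, Z w (α l)) (c.φ y)) :
    c.pull y (HolGerm.mk _ h) =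
      tval (fun α => c.pull y (HolGerm.mk (A α) (hA α))) (c.pullVec y Z hZ) := by
  let S : (I → J) → analyticSubring (c.φ y) := fun α => ⟨A α, hA α⟩
  let z : J → analyticSubring (c.φ y) := fun a => ⟨fun w => Z w a, analyticAt_pi_iff.mp hZ a⟩
  have h1 := map_tval ((c.pull y).comp (analyticSubring.toHolGerm (c.φ y))) S z
  refine Eq.trans ?_ h1
  refine congrArg (c.pull y) (HolGerm.mk_eq_mk_iff (hG := (tval S z).2).mpr
    (Filter.Eventually.of_forall fun w => ?_))
  simp [tval, S, z]

end LocalModel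

namespace HolBundle.OSection

variable {X : ComplexSpace.{u}} {E : HolBundle X} {r : ℕ}

/-- Near `y` in the local model, the section is the polynomial with coefficients `A`, as far as its
values at vectors with property `Q` are concerned. -/
def IsRepresentedBy (s : E.OSection r) {i : E.ι} {c : X.Model} (Q : (E.J i → ℂ) → Prop)
    (A : (Fin r → E.J i) → (Fin c.n → ℂ) → ℂ) (y : c.U) : Prop :=
  ∃ hA : ∀ α, AnalyticAt ℂ (A α) (c.φ y), ∀ (hy : y.1 ∈ E.U i) (Z : (Fin c.n → ℂ) → E.J i → ℂ)
    (hZ : AnalyticAt ℂ Z (c.φ y)), Q (Z (c.φ y)) → s.val i y.1 hy (c.pullVec y Z hZ) =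
      tval (fun α => c.pull y (HolGerm.mk (A α) (hA α))) (c.pullVec y Z hZ)

/-- The key step towards the polynomial representation. The coefficients come from the Taylor
expansion of the section at the coordinate vector `e_a`; along the line through a vector `Z` in
direction `e_a` the section is a function modulo the ideal of the model, with a pole at infinity
that the expansion controls, so that Liouville's theorem applies. -/
theorem exists_eventually_val_eq_of_ne (s : E.OSection r) {i : E.ι} {c : X.Model} {x : c.U}
    (hx : x.1 ∈ E.U i) (a : E.J i) :
    ∃ A : (Fin r → E.J i) → (Fin c.n → ℂ) → ℂ,
      ∀ᶠ y : c.U in 𝓝 x, s.IsRepresentedBy (fun z => ∃ b, b ≠ a ∧ z b ≠ 0) A y := by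
  obtain ⟨σ, hσ⟩ := s.holo i c
  have hv₀ : (Pi.single a 1 : E.J i → ℂ) ≠ 0 := fun h => by
    simpa using congrFun h a
  obtain ⟨h, hmem, hσh, -⟩ := hσ x _ hx hv₀
  set v₀ : E.J i → ℂ := Pi.single a 1 with hv₀def
  obtain ⟨A, K, hA, hK, hAK⟩ := (h.analytic_F _ hmem).exists_taylor (r + 1)
  refine ⟨A r, ?_⟩
  obtain ⟨ε, hε, hball⟩ := Metric.eventually_nhds_iff_ball.mp
    ((h.isOpen_N.mem_nhds hmem |> Filter.eventually_mem_set.mpr).and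
      ((Filter.eventually_all.mpr fun α => (hK α).eventually_analyticAt).and hAK.eventually_nhds))
  rw [← ball_prod_same] at hball
  have hA' : ∀ᶠ w in 𝓝 (c.φ x), ∀ m ∈ Finset.range (r + 1), ∀ α, AnalyticAt ℂ (A m α) w :=
    (Filter.eventually_all_finset _).mpr fun m _ =>
      Filter.eventually_all.mpr fun α => (hA m α).eventually_analyticAt
  filter_upwards [c.isEmbedding_φ.continuous.continuousAt.eventually hA',
    c.isEmbedding_φ.continuous.continuousAt.eventually (Metric.ball_mem_nhds _ hε)]
    with y hAy hyε
  have hAr := hAy r (Finset.self_mem_range_succ r)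
  refine ⟨hAr, fun hy Z hZ hb => ?_⟩
  obtain ⟨b, hba, hb⟩ := hb
  set b₀ := c.φ y
  -- the line through `Z` in direction `e_a`
  let P : ℂ → E.J i → ℂ := fun τ => Z b₀ + τ • v₀
  have hP : ∀ τ, P τ ≠ 0 := fun τ hτ => hb (by
    have := congrFun hτ b
    simpa [P, hv₀def, hba] using this)
  have hPc : Continuous P := by fun_prop
  choose g hgmem hσg hgval using fun τ => hσ y (P τ) hy (hP τ)
  let θ : (Fin c.n → ℂ) × ℂ → (Fin c.n → ℂ) × (E.J i → ℂ) := fun q => (q.1, Z q.1 + q.2 • v₀)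
  have hθ : ∀ τ, AnalyticAt ℂ θ (b₀, τ) := fun τ =>
    analyticAt_fst.prod ((hZ.fun_comp (f := Prod.fst) (x := (b₀, τ)) analyticAt_fst).add
      (analyticAt_snd.smul analyticAt_const))
  have hgan : ∀ τ, AnalyticAt ℂ (fun q => (g τ).F (θ q)) (b₀, τ) := fun τ =>
    AnalyticAt.fun_comp (g := (g τ).F) ((g τ).analytic_F _ (hgmem τ)) (hθ τ)
  have hcmp : ∀ (h₁ h₂ : HomogFun c.n (E.J i) r) (τ : ℂ) (h1 : (b₀, P τ) ∈ h₁.N)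
      (h2 : (b₀, P τ) ∈ h₂.N),
      σ y (P τ) = Ideal.Quotient.mk _ (HolGerm.mk h₁.F (h₁.analytic_F _ h1)) →
      σ y (P τ) = Ideal.Quotient.mk _ (HolGerm.mk h₂.F (h₂.analytic_F _ h2)) →
      IdealGerm (fun j q => c.f j q.1) (fun q => h₁.F (θ q) - h₂.F (θ q)) (b₀, τ) := by
    intro h₁ h₂ τ h1 h2 e1 e2
    exact IdealGerm.comp (θ := θ) (p' := (b₀, τ))
      ((c.mk_eq_mk_prodStalk_iff y (P τ) (h₁.analytic_F _ h1) (h₂.analytic_F _ h2)).mp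
        (e1.symm.trans e2)) (hθ τ)
  -- the same line near infinity, in the coordinate `τ⁻¹`
  let θ' : (Fin c.n → ℂ) × ℂ → (Fin c.n → ℂ) × (E.J i → ℂ) := fun q => (q.1, v₀ + q.2 • Z q.1)
  have hθ' : AnalyticAt ℂ θ' (b₀, 0) := analyticAt_fst.prod (analyticAt_const.add
    (analyticAt_snd.smul (hZ.fun_comp (f := Prod.fst) (x := (b₀, (0 : ℂ))) analyticAt_fst)))
  have hθ'0 : θ' (b₀, 0) = (b₀, v₀) := by simp [θ']
  obtain ⟨-, hKy, hTy⟩ := hball (b₀, v₀) ⟨hyε, Metric.mem_ball_self hε⟩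
  have hprod : ∀ {m : ℕ} (α : Fin m → E.J i), AnalyticAt ℂ (fun w => ∏ l, Z w (α l)) b₀ :=
    fun α => Finset.analyticAt_fun_prod _ fun l _ => analyticAt_pi_iff.mp hZ (α l)
  -- the coefficients in the expansion at infinity
  let C : ℕ → (Fin c.n → ℂ) → ℂ := fun m w =>
    if m ∈ Finset.range (r + 1) then ∑ α, A m α w * ∏ l, Z w (α l) else 0
  have hC : ∀ m, AnalyticAt ℂ (C m) b₀ := by
    intro m
    by_cases hm : m ∈ Finset.range (r + 1)
    · simp only [C, if_pos hm]
      exact Finset.analyticAt_fun_sum _ fun α _ => (hAy m hm α).mul (hprod α)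
    · simp only [C, if_neg hm]
      exact analyticAt_const
  have hCr : C r = fun w => ∑ α, A r α w * ∏ l, Z w (α l) := by
    simp [C]
  have key := IdealGerm.liouville (f := c.f) (b := b₀) (F := fun τ q => (g τ).F (θ q)) hgan ?_
    (r := r) (c := C) (K := fun q => ∑ α, K α (θ' q) * ∏ l, Z q.1 (α l)) hC ?_
    (F' := fun q => h.F (θ' q)) ?_ ?_
  · have h0 : (b₀, Z b₀) ∈ (g 0).N := by
      have := hgmem 0
      simpa [P] using this
    have hne : Z b₀ ≠ 0 := fun hz => hb (congrFun hz b)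
    rw [hgval 0 y hy Z hZ h0 hne, ← c.pull_sum_mul_prod y hAr hZ (hCr ▸ hC r)]
    refine (c.pull_mk_eq_pull_mk_iff y _ _).mpr
      (key.congr (Filter.Eventually.of_forall fun w => ?_))
    simp [hCr, θ]
  · intro τ
    have hcont : ContinuousAt (fun η => (b₀, P η)) τ := (continuous_const.prodMk hPc).continuousAt
    filter_upwards [hcont.eventually ((g τ).isOpen_N.mem_nhds (hgmem τ))] with η hη
    exact hcmp (g η) (g τ) η (hgmem η) hη (hσg η y _ (hgmem η) hy (hP η)) (hσg τ y _ hη hy (hP η))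
  · refine Finset.analyticAt_fun_sum _ fun α _ => ?_
    refine AnalyticAt.mul ?_ ((hprod α).fun_comp (f := Prod.fst) (x := (b₀, (0 : ℂ)))
      analyticAt_fst)
    exact AnalyticAt.fun_comp (g := K α) (hθ'0 ▸ hKy α) hθ'
  · have hcont := hθ'.continuousAt
    rw [ContinuousAt, hθ'0] at hcont
    filter_upwards [hcont.eventually hTy] with q hq
    have hpr : ∀ {m : ℕ} (α : Fin m → E.J i),
        ∏ l, ((θ' q).2 (α l) - v₀ (α l)) = (∏ l, Z q.1 (α l)) * q.2 ^ m := by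
      intro m α
      simp [θ', Finset.prod_mul_distrib, mul_comm]
    have hCm : ∀ m ∈ Finset.range (r + 1), C m q.1 * q.2 ^ m =
        ∑ α : Fin m → E.J i, A m α (θ' q).1 * ∏ l, ((θ' q).2 (α l) - v₀ (α l)) := by
      intro m hm
      simp only [C, if_pos hm, Finset.sum_mul, hpr, mul_assoc, θ']
    rw [← Finset.sum_range_succ (fun m => C m q.1 * q.2 ^ m), Finset.sum_congr rfl hCm, hq,
      Finset.sum_mul]
    simp only [hpr, mul_assoc]
  · have hlim : Filter.Tendsto (fun τ : ℂ => (b₀, v₀ + τ⁻¹ • Z b₀)) (Bornology.cobounded ℂ)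
        (𝓝 (b₀, v₀)) := by
      have h1 : ContinuousAt (fun t : ℂ => (b₀, v₀ + t • Z b₀)) 0 := by fun_prop
      have h2 := h1.tendsto.comp Filter.tendsto_inv₀_cobounded
      simpa [Function.comp_def] using h2
    have hN : h.N ∈ 𝓝 (b₀, v₀) :=
      h.isOpen_N.mem_nhds (hball (b₀, v₀) ⟨hyε, Metric.mem_ball_self hε⟩).1
    filter_upwards [hlim.eventually hN, Bornology.eventually_ne_cobounded (0 : ℂ)] with τ hτ hτ0
    have hsmul : ∀ (w : Fin c.n → ℂ) (η : ℂ), η ≠ 0 →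
        Z w + η • v₀ = η • (v₀ + η⁻¹ • Z w) := by
      intro w η hη
      rw [smul_add, smul_inv_smul₀ hη, add_comm]
    have hτN : (b₀, P τ) ∈ h.N := by
      have := h.smul_mem _ _ τ hτ0 hτ
      rwa [← hsmul _ _ hτ0] at this
    refine (hcmp (g τ) h τ (hgmem τ) hτN (hσg τ y _ (hgmem τ) hy (hP τ))
      (hσh y _ hτN hy (hP τ))).congr ?_
    have h3 : AnalyticAt ℂ (fun q : (Fin c.n → ℂ) × ℂ => (q.1, v₀ + q.2⁻¹ • Z q.1)) (b₀, τ) :=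
      analyticAt_fst.prod (analyticAt_const.add ((analyticAt_snd.fun_inv hτ0).smul
        (hZ.fun_comp (f := Prod.fst) (x := (b₀, τ)) analyticAt_fst)))
    have h4 : ∀ᶠ q : (Fin c.n → ℂ) × ℂ in 𝓝 (b₀, τ), q.2 ≠ 0 :=
      continuousAt_snd.eventually_ne hτ0
    filter_upwards [h3.continuousAt.eventually (h.isOpen_N.mem_nhds hτ), h4] with q hq hq0
    have h5 := h.homog _ _ q.2 hq0 hq
    rw [← hsmul _ _ hq0] at h5
    simp only [θ, θ']
    rw [h5]

/-- In rank one the section is determined by its value at a single vector. -/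
theorem exists_eventually_val_eq_of_subsingleton (s : E.OSection r) {i : E.ι} {c : X.Model}
    {x : c.U} (hx : x.1 ∈ E.U i) {a : E.J i} (ha : ∀ b, b = a) :
    ∃ A : (Fin r → E.J i) → (Fin c.n → ℂ) → ℂ,
      ∀ᶠ y : c.U in 𝓝 x, s.IsRepresentedBy (fun z => z ≠ 0) A y := by
  obtain ⟨σ, hσ⟩ := s.holo i c
  let _ : Unique (E.J i) := ⟨⟨a⟩, ha⟩
  have hv : ∀ z : E.J i → ℂ, z = z a • (1 : E.J i → ℂ) := fun z => funext fun b => by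
    rw [ha b]
    simp
  have hv₁ : (1 : E.J i → ℂ) ≠ 0 := fun h => one_ne_zero (congrFun h a)
  obtain ⟨h, hmem, -, hval⟩ := hσ x _ hx hv₁
  have hN : ∀ᶠ w in 𝓝 (c.φ x), (w, (1 : E.J i → ℂ)) ∈ h.N :=
    (continuous_id.prodMk continuous_const).continuousAt.eventually (h.isOpen_N.mem_nhds hmem)
  have hA : ∀ w, (w, (1 : E.J i → ℂ)) ∈ h.N → AnalyticAt ℂ (fun w => h.F (w, 1)) w :=
    fun w hw => (h.analytic_F _ hw).fun_comp (f := fun w => (w, (1 : E.J i → ℂ)))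
      (analyticAt_id.prod analyticAt_const)
  refine ⟨fun _ w => h.F (w, 1), ?_⟩
  filter_upwards [c.isEmbedding_φ.continuous.continuousAt.eventually hN.eventually_nhds] with y hNy
  refine ⟨fun _ => hA _ hNy.self_of_nhds, fun hy Z hZ hZ0 => ?_⟩
  have ha0 : Z (c.φ y) a ≠ 0 := fun h0 => hZ0 (by rw [hv (Z (c.φ y)), h0, zero_smul])
  have hmem' : (c.φ y, Z (c.φ y)) ∈ h.N := by
    rw [hv (Z (c.φ y))]
    exact h.smul_mem _ _ _ ha0 hNy.self_of_nhds
  have hZa := analyticAt_pi_iff.mp hZ a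
  rw [hval y hy Z hZ hmem' hZ0, ← c.pull_sum_mul_prod y _ hZ (Finset.analyticAt_fun_sum _ fun α _ =>
    (hA _ hNy.self_of_nhds).mul (Finset.analyticAt_fun_prod _ fun l _ =>
      analyticAt_pi_iff.mp hZ (α l)))]
  refine congrArg (c.pull y) (HolGerm.mk_eq_mk_iff.mpr ?_)
  filter_upwards [hNy, hZa.continuousAt.eventually_ne ha0] with w hw hw0
  rw [Fintype.sum_unique, hv (Z w), h.homog _ _ _ hw0 hw]
  simp [mul_comm]

/-- The coefficients of a homogeneous polynomial, made symmetric. -/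
noncomputable def symmCoeff {V J : Type} (A : (Fin r → J) → V → ℂ) (α : Fin r → J) (w : V) : ℂ :=
  (r.factorial : ℂ)⁻¹ * symm (fun β => A β w) α

theorem analyticAt_symmCoeff {V J : Type} [NormedAddCommGroup V] [NormedSpace ℂ V]
    {A : (Fin r → J) → V → ℂ} {w : V} (hA : ∀ α, AnalyticAt ℂ (A α) w) (α : Fin r → J) :
    AnalyticAt ℂ (symmCoeff A α) w :=
  analyticAt_const.mul (Finset.analyticAt_fun_sum _ fun _ _ => hA _)

theorem symmCoeff_comp_perm {V J : Type} (A : (Fin r → J) → V → ℂ) (τ : Equiv.Perm (Fin r))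
    (α : Fin r → J) : symmCoeff A (α ∘ τ) = symmCoeff A α :=
  funext fun w => by rw [symmCoeff, symm_comp_perm, symmCoeff]

theorem IsRepresentedBy.symmCoeff {s : E.OSection r} {i : E.ι} {c : X.Model}
    {Q : (E.J i → ℂ) → Prop} {A : (Fin r → E.J i) → (Fin c.n → ℂ) → ℂ} {y : c.U}
    (h : s.IsRepresentedBy Q A y) : s.IsRepresentedBy Q (symmCoeff A) y := by
  obtain ⟨hA, h⟩ := h
  refine ⟨analyticAt_symmCoeff hA, fun hy Z hZ hQ => ?_⟩
  have han : ∀ B : (Fin r → E.J i) → (Fin c.n → ℂ) → ℂ, (∀ α, AnalyticAt ℂ (B α) (c.φ y)) →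
      AnalyticAt ℂ (fun w => ∑ α, B α w * ∏ l, Z w (α l)) (c.φ y) := fun B hB =>
    Finset.analyticAt_fun_sum _ fun α _ => (hB α).mul (Finset.analyticAt_fun_prod _ fun l _ =>
      analyticAt_pi_iff.mp hZ (α l))
  rw [h hy Z hZ hQ, ← c.pull_sum_mul_prod y hA hZ (han _ hA),
    ← c.pull_sum_mul_prod y (analyticAt_symmCoeff hA) hZ (han _ (analyticAt_symmCoeff hA))]
  refine congrArg (c.pull y) (HolGerm.mk_eq_mk_iff.mpr (Filter.Eventually.of_forall fun w => ?_))
  have h1 := tval_symm (fun β => A β w) (Z w)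
  rw [tval, tval, Fintype.card_fin] at h1
  simp only [OSection.symmCoeff, mul_assoc, ← Finset.mul_sum]
  rw [h1, inv_mul_cancel_left₀ (Nat.cast_ne_zero.mpr r.factorial_ne_zero)]

end HolBundle.OSection

end CplxGeom

namespace CplxGeom

open TensorWord Matrix

variable {X : ComplexSpace.{u}}

/-- The germs of constant functions at `x`, as a ring homomorphism. -/
noncomputable def ComplexSpace.constGermHom (X : ComplexSpace.{u}) (x : X.Pt) : ℂ →+* X.Stalk x :=
  (X.germ ⊤ x trivial).comp X.const

theorem LocalModel.pullVec_const (c : X.Model) {J : Type} [Fintype J] (y : c.U) (z : J → ℂ) :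
    c.pullVec y (fun _ => z) analyticAt_const = X.constGermHom y.1 ∘ z :=
  funext fun a => c.pull_const y (z a)

theorem eq_of_tval_constGermHom_eq {I J : Type} [Fintype I] [DecidableEq I] [Fintype J]
    {x : X.Pt} {S T : (I → J) → X.Stalk x} (hS : ∀ (τ : Equiv.Perm I) α, S (α ∘ τ) = S α)
    (hT : ∀ (τ : Equiv.Perm I) α, T (α ∘ τ) = T α)
    (h : ∀ z : J → ℂ, (∀ j, z j ≠ 0) →
      tval S (X.constGermHom x ∘ z) = tval T (X.constGermHom x ∘ z)) : S = T := by
  refine sub_eq_zero.mp (eq_zero_of_tval_const_eq_zero (X.constGermHom x) (f := S - T)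
    (fun τ α => congrArg₂ (· - ·) (hS τ α) (hT τ α)) fun z hz => ?_)
  have h1 := sub_eq_zero.mpr (h z hz)
  simpa [tval, sub_mul, Finset.sum_sub_distrib] using h1

theorem LocalModel.exists_isUnit_pullVec_iff (c : X.Model) {J : Type} [Fintype J] (y : c.U)
    {Z : (Fin c.n → ℂ) → J → ℂ} (hZ : AnalyticAt ℂ Z (c.φ y)) :
    (∃ a, IsUnit (c.pullVec y Z hZ a)) ↔ Z (c.φ y) ≠ 0 := by
  simp only [c.isUnit_iff_eval_ne_zero, LocalModel.pullVec, eval_pull, HolGerm.value_mk]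
  exact Function.ne_iff.symm

namespace HolBundle.OSection

variable {E : HolBundle X} {r : ℕ}

/-- A section of `𝒪(r)` is locally given by a symmetric tensor with holomorphic coefficients. -/
theorem exists_eventually_isRepresentedBy (s : E.OSection r) {i : E.ι} {c : X.Model} {x : c.U}
    (hx : x.1 ∈ E.U i) :
    ∃ A : (Fin r → E.J i) → (Fin c.n → ℂ) → ℂ, (∀ (τ : Equiv.Perm (Fin r)) α, A (α ∘ τ) = A α) ∧
      ∀ᶠ y : c.U in 𝓝 x, s.IsRepresentedBy (fun z => z ≠ 0) A y := by
  rcases isEmpty_or_nonempty (E.J i) with hJ | ⟨⟨a⟩⟩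
  · exact ⟨fun _ _ => 0, fun _ _ => rfl, Filter.Eventually.of_forall fun y =>
      ⟨fun _ => analyticAt_const, fun _ _ _ hZ => (hZ (Subsingleton.elim _ _)).elim⟩⟩
  by_cases hsub : ∀ b, b = a
  · obtain ⟨A, h⟩ := s.exists_eventually_val_eq_of_subsingleton hx hsub
    exact ⟨symmCoeff A, fun τ => symmCoeff_comp_perm A τ, h.mono fun y => IsRepresentedBy.symmCoeff⟩
  push Not at hsub
  obtain ⟨b, hba⟩ := hsub
  obtain ⟨A, hA⟩ := s.exists_eventually_val_eq_of_ne hx a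
  obtain ⟨B, hB⟩ := s.exists_eventually_val_eq_of_ne hx b
  refine ⟨symmCoeff A, fun τ => symmCoeff_comp_perm A τ, ?_⟩
  filter_upwards [hA, hB] with y hAy hBy
  obtain ⟨hA', hAy⟩ := hAy.symmCoeff
  obtain ⟨hB', hBy⟩ := hBy.symmCoeff
  refine ⟨hA', fun hy Z hZ hZ0 => ?_⟩
  -- the two tensors agree because they have the same values at constant vectors
  have heq : (fun α => c.pull y (HolGerm.mk (symmCoeff A α) (hA' α))) =
      fun α => c.pull y (HolGerm.mk (symmCoeff B α) (hB' α)) := by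
    refine eq_of_tval_constGermHom_eq (fun τ α => ?_) (fun τ α => ?_) fun z hz => ?_
    · simp only [symmCoeff_comp_perm]
    · simp only [symmCoeff_comp_perm]
    · rw [← c.pullVec_const, ← hAy hy _ _ ⟨b, hba, hz b⟩, hBy hy _ _ ⟨a, hba.symm, hz a⟩]
  obtain ⟨d, hd⟩ := Function.ne_iff.mp hZ0
  by_cases hda : d = a
  · subst hda
    rw [heq]
    exact hBy hy Z hZ ⟨d, hba.symm, hd⟩
  · exact hAy hy Z hZ ⟨d, hda, hd⟩

/-- `S` is the symmetric coefficient tensor of `s` at `x` in the `i`-th trivialization. -/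
def IsCoeff (s : E.OSection r) {i : E.ι} {x : X.Pt} (hx : x ∈ E.U i)
    (S : (Fin r → E.J i) → X.Stalk x) : Prop :=
  (∀ (τ : Equiv.Perm (Fin r)) α, S (α ∘ τ) = S α) ∧
    ∀ ζ : E.J i → X.Stalk x, (∃ a, IsUnit (ζ a)) → s.val i x hx ζ = tval S ζ

theorem IsCoeff.unique {s : E.OSection r} (hr : 0 < r) {i : E.ι} {x : X.Pt} {hx : x ∈ E.U i}
    {S T : (Fin r → E.J i) → X.Stalk x} (hS : s.IsCoeff hx S) (hT : s.IsCoeff hx T) : S = T := by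
  -- in rank zero no vector has a unit entry, but there are no index tuples of positive length
  rcases isEmpty_or_nonempty (E.J i) with hJ | ⟨⟨a⟩⟩
  · exact funext fun α => isEmptyElim (α ⟨0, hr⟩)
  · refine eq_of_tval_constGermHom_eq hS.1 hT.1 fun z hz => ?_
    have hu : ∃ a, IsUnit ((X.constGermHom x ∘ z) a) :=
      ⟨a, (IsUnit.mk0 _ (hz a)).map (X.constGermHom x)⟩
    rw [← hS.2 _ hu, hT.2 _ hu]

theorem IsRepresentedBy.isCoeff {s : E.OSection r} {i : E.ι} {c : X.Model}
    {A : (Fin r → E.J i) → (Fin c.n → ℂ) → ℂ} {y : c.U}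
    (h : s.IsRepresentedBy (fun z => z ≠ 0) A y)
    (hA : ∀ (τ : Equiv.Perm (Fin r)) α, A (α ∘ τ) = A α) (hy : y.1 ∈ E.U i) :
    s.IsCoeff hy fun α => c.pull y (HolGerm.mk (A α) (h.1 α)) := by
  refine ⟨fun τ α => by simp only [hA], fun ζ hζ => ?_⟩
  obtain ⟨Z, hZ, rfl, -⟩ := c.exists_eq_pullVec y ζ
  exact h.2 hy Z hZ ((c.exists_isUnit_pullVec_iff y hZ).mp hζ)

theorem exists_isCoeff (s : E.OSection r) {i : E.ι} {x : X.Pt} (hx : x ∈ E.U i) :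
    ∃ S, s.IsCoeff hx S := by
  obtain ⟨c, hc⟩ := X.exists_model x
  obtain ⟨A, hA, h⟩ := s.exists_eventually_isRepresentedBy (c := c) (x := ⟨x, hc⟩) hx
  exact ⟨_, h.self_of_nhds.isCoeff hA hx⟩

/-- The symmetric coefficient tensor of a section of `𝒪(r)`, which is therefore the same as a
section of the `r`-th symmetric power of `E`. -/
noncomputable def coeff (s : E.OSection r) {i : E.ι} {x : X.Pt} (hx : x ∈ E.U i) :
    (Fin r → E.J i) → X.Stalk x :=
  (s.exists_isCoeff hx).choose

theorem isCoeff_coeff (s : E.OSection r) {i : E.ι} {x : X.Pt} (hx : x ∈ E.U i) :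
    s.IsCoeff hx (s.coeff hx) :=
  (s.exists_isCoeff hx).choose_spec

theorem exists_eventually_coeff_eq (hr : 0 < r) (s : E.OSection r) {i : E.ι} {c : X.Model}
    {x : c.U} (hx : x.1 ∈ E.U i) :
    ∃ A : (Fin r → E.J i) → (Fin c.n → ℂ) → ℂ, (∀ α, AnalyticAt ℂ (A α) (c.φ x)) ∧
      ∀ᶠ y : c.U in 𝓝 x, ∀ hA : ∀ α, AnalyticAt ℂ (A α) (c.φ y), ∀ hy : y.1 ∈ E.U i,
        s.coeff hy = fun α => c.pull y (HolGerm.mk (A α) (hA α)) := by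
  obtain ⟨A, hA, h⟩ := s.exists_eventually_isRepresentedBy hx
  exact ⟨A, h.self_of_nhds.1, h.mono fun y hy _ hyi =>
    (s.isCoeff_coeff hyi).unique hr (hy.isCoeff hA hyi)⟩

end HolBundle.OSection

namespace HolBundle

/-- The transition matrix of `E` at a point. -/
noncomputable def gAt (E : HolBundle X) {i j : E.ι} {x : X.Pt} (hi : x ∈ E.U i)
    (hj : x ∈ E.U j) : Matrix (E.J i) (E.J j) (X.Stalk x) :=
  (E.g i j).map (X.germ _ x (ComplexSpace.mem_inf hi hj))

theorem gAt_mul_gAt (E : HolBundle X) {i j : E.ι} {x : X.Pt} (hi : x ∈ E.U i) (hj : x ∈ E.U j) :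
    E.gAt hi hj * E.gAt hj hi = 1 :=
  (E.g_mul i j i x hi hj hi).trans (E.g_self i x hi)

theorem exists_isUnit_vecMul_gAt (E : HolBundle X) {i j : E.ι} {x : X.Pt} (hi : x ∈ E.U i)
    (hj : x ∈ E.U j) {ζ : E.J i → X.Stalk x} (hζ : ∃ a, IsUnit (ζ a)) :
    ∃ b, IsUnit ((ζ ᵥ* E.gAt hi hj) b) := by
  obtain ⟨c, hc⟩ := X.exists_model x
  simp only [c.isUnit_iff_eval_ne_zero ⟨x, hc⟩] at hζ ⊢
  obtain ⟨a, ha⟩ := hζ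
  by_contra! h0
  refine ha ?_
  have h1 : ζ = (ζ ᵥ* E.gAt hi hj) ᵥ* E.gAt hj hi := by
    rw [vecMul_vecMul, gAt_mul_gAt, vecMul_one]
  rw [h1, RingHom.map_vecMul, show c.eval ⟨x, hc⟩ ∘ (ζ ᵥ* E.gAt hi hj) = 0 from funext h0,
    zero_vecMul, Pi.zero_apply]

theorem OSection.coeff_eq_mulVec {E : HolBundle X} {r : ℕ} (hr : 0 < r) (s : E.OSection r)
    {i j : E.ι} {x : X.Pt} (hi : x ∈ E.U i) (hj : x ∈ E.U j) :
    s.coeff hi = tmat (Fin r) (E.gAt hi hj) *ᵥ s.coeff hj := by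
  refine (s.isCoeff_coeff hi).unique hr ⟨fun τ α => ?_, fun ζ hζ => ?_⟩
  · rw [mulVec, dotProduct, mulVec, dotProduct,
      ← Equiv.sum_comp (Equiv.arrowCongr τ.symm (Equiv.refl (E.J j)))]
    refine Finset.sum_congr rfl fun β _ => ?_
    have h1 : (Equiv.arrowCongr τ.symm (Equiv.refl (E.J j))) β = β ∘ τ := rfl
    rw [h1, tmat_comp_perm, (s.isCoeff_coeff hj).1]
  · rw [tval_tmat_mulVec, ← (s.isCoeff_coeff hj).2 _ (E.exists_isUnit_vecMul_gAt hi hj hζ)]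
    exact (s.val_transition i j x hi hj ζ hζ).symm

end HolBundle

end CplxGeom

/-! ### Sections on the tensor product -/

namespace TensorWord

open Matrix

section WordVal

variable {R R' : Type*} [CommRing R] [CommRing R'] {J J' K K' : Type*} [Fintype J] [DecidableEq J]
  [Fintype J'] [DecidableEq J'] [Fintype K] [Fintype K'] {r m : ℕ}

/-- A power of the trace of a product of operators `symOp q S T'`, where `T'` runs through the
tensors `T j` transported by `ζ`, a vector indexed by pairs that is read as a matrix. -/
def wordVal (q k : ℕ) (S : (Fin r → J) → R) (T : Fin m → (Fin r → K) → R) (ζ : J × K → R) : R :=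
  wordTrace q S (List.ofFn fun j => tmat (Fin r) (Matrix.of fun a b => ζ (a, b)) *ᵥ T j) ^ k

theorem map_wordVal (f : R →+* R') (q k : ℕ) (S : (Fin r → J) → R) (T : Fin m → (Fin r → K) → R)
    (ζ : J × K → R) :
    f (wordVal q k S T ζ) = wordVal q k (f ∘ S) (fun j => f ∘ T j) (f ∘ ζ) := by
  rw [wordVal, map_pow, map_wordTrace, List.map_ofFn]
  congr 4
  funext j
  exact map_tmat_mulVec f _ _

theorem wordVal_smul (q k : ℕ) (S : (Fin r → J) → R) (T : Fin m → (Fin r → K) → R) (ζ : J × K → R)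
    (a : R) : wordVal q k S T (a • ζ) = a ^ (r * m * k) * wordVal q k S T ζ := by
  have h1 : (Matrix.of fun b c => (a • ζ) (b, c)) = a • Matrix.of fun b c => ζ (b, c) := rfl
  have h2 := wordTrace_smul (q := q) S
    (List.ofFn fun j => tmat (Fin r) (Matrix.of fun b c => ζ (b, c)) *ᵥ T j) (a ^ r)
  rw [List.map_ofFn, List.length_ofFn] at h2
  rw [wordVal, wordVal, h1, tmat_smul, Fintype.card_fin]
  simp only [smul_mulVec]
  rw [pow_mul, pow_mul, ← mul_pow]
  exact congrArg (· ^ k) h2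

theorem wordVal_vecMul_kronecker (q k : ℕ) (S : (Fin r → J') → R) (T : Fin m → (Fin r → K') → R)
    (ζ : J × K → R) (g : Matrix J J' R) (g' : Matrix J' J R) (h : Matrix K K' R) (hg : g * g' = 1)
    (hg' : g' * g = 1) :
    wordVal q k S T (ζ ᵥ* kroneckerMap (· * ·) g h) =
      wordVal q k (tmat (Fin r) g *ᵥ S) (fun j => tmat (Fin r) h *ᵥ T j) ζ := by
  have h1 : (Matrix.of fun a b => (ζ ᵥ* kroneckerMap (· * ·) g h) (a, b)) =
      gᵀ * ((Matrix.of fun a b => ζ (a, b)) * h) := by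
    ext a b
    simp only [Matrix.of_apply, vecMul, dotProduct, Fintype.sum_prod_type, mul_apply,
      transpose_apply, kroneckerMap_apply, Finset.mul_sum]
    exact Finset.sum_congr rfl fun _ _ => Finset.sum_congr rfl fun _ _ => by ring
  have h2 := wordTrace_tmat (q := q) gᵀ g'ᵀ (by rw [← transpose_mul, hg', transpose_one])
    (by rw [← transpose_mul, hg, transpose_one]) S
    (List.ofFn fun j => tmat (Fin r) (Matrix.of fun a b => ζ (a, b)) *ᵥ tmat (Fin r) h *ᵥ T j)
  rw [List.map_ofFn, tmat_transpose, vecMul_transpose] at h2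
  rw [wordVal, wordVal, h1, ← h2, tmat_mul, tmat_mul]
  simp only [← mulVec_mulVec]
  rfl

end WordVal

end TensorWord

namespace CplxGeom

open TensorWord Matrix

theorem _root_.AnalyticAt.comp_fst {V W : Type*} [NormedAddCommGroup V] [NormedSpace ℂ V]
    [NormedAddCommGroup W] [NormedSpace ℂ W] {f : V → ℂ} {p : V × W} (hf : AnalyticAt ℂ f p.1) :
    AnalyticAt ℂ (fun q : V × W => f q.1) p :=
  hf.fun_comp (f := Prod.fst) analyticAt_fst

theorem analyticAt_snd_apply {V J : Type*} [NormedAddCommGroup V] [NormedSpace ℂ V] [Fintype J]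
    {p : V × (J → ℂ)} (a : J) : AnalyticAt ℂ (fun q : V × (J → ℂ) => q.2 a) p :=
  analyticAt_pi_iff.mp analyticAt_snd a

section WordVal

variable {J K : Type} [Fintype J] [DecidableEq J] [Fintype K] {r m : ℕ}
  {W : Type} [NormedAddCommGroup W] [NormedSpace ℂ W] {p : W} {S : (Fin r → J) → W → ℂ}
  {T : Fin m → (Fin r → K) → W → ℂ} {Z : J × K → W → ℂ}

/-- Evaluation at `w` of functions that are holomorphic near `p`. -/
def analyticSubring.evalHom (p w : W) : analyticSubring p →+* ℂ where
  toFun F := F.1 w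
  map_one' := rfl
  map_mul' _ _ := rfl
  map_zero' := rfl
  map_add' _ _ := rfl

theorem coe_wordVal_analyticSubring (q k : ℕ) (hS : ∀ α, AnalyticAt ℂ (S α) p)
    (hT : ∀ j α, AnalyticAt ℂ (T j α) p) (hZ : ∀ a, AnalyticAt ℂ (Z a) p) :
    (wordVal q k (fun α => (⟨S α, hS α⟩ : analyticSubring p)) (fun j α => ⟨T j α, hT j α⟩)
      fun a => ⟨Z a, hZ a⟩).1 =
    fun w => wordVal q k (fun α => S α w) (fun j α => T j α w) fun a => Z a w :=
  funext fun w => map_wordVal (analyticSubring.evalHom p w) q k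
    (fun α => (⟨S α, hS α⟩ : analyticSubring p)) (fun j α => ⟨T j α, hT j α⟩) fun a => ⟨Z a, hZ a⟩

theorem analyticAt_wordVal (q k : ℕ) (hS : ∀ α, AnalyticAt ℂ (S α) p)
    (hT : ∀ j α, AnalyticAt ℂ (T j α) p) (hZ : ∀ a, AnalyticAt ℂ (Z a) p) :
    AnalyticAt ℂ (fun w => wordVal q k (fun α => S α w) (fun j α => T j α w) fun a => Z a w) p := by
  rw [← coe_wordVal_analyticSubring q k hS hT hZ]
  exact (wordVal q k (fun α => (⟨S α, hS α⟩ : analyticSubring p)) (fun j α => ⟨T j α, hT j α⟩)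
      fun a => ⟨Z a, hZ a⟩).2

theorem map_mk_wordVal {R : Type*} [CommRing R] (f : HolGerm p →+* R) (q k : ℕ)
    (hS : ∀ α, AnalyticAt ℂ (S α) p) (hT : ∀ j α, AnalyticAt ℂ (T j α) p)
    (hZ : ∀ a, AnalyticAt ℂ (Z a) p)
    (h : AnalyticAt ℂ (fun w => wordVal q k (fun α => S α w) (fun j α => T j α w) fun a => Z a w)
      p) :
    f (HolGerm.mk _ h) = wordVal q k (fun α => f (HolGerm.mk (S α) (hS α)))
      (fun j α => f (HolGerm.mk (T j α) (hT j α))) fun a => f (HolGerm.mk (Z a) (hZ a)) := by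
  refine Eq.trans (congrArg f ?_)
    (map_wordVal (f.comp (analyticSubring.toHolGerm p)) q k (fun α => ⟨S α, hS α⟩)
      (fun j α => ⟨T j α, hT j α⟩) fun a => ⟨Z a, hZ a⟩)
  exact Subtype.ext (congrArg (fun G : W → ℂ => (G : Filter.Germ (𝓝 p) ℂ))
    (coe_wordVal_analyticSubring q k hS hT hZ).symm)

end WordVal

variable {X : ComplexSpace.{u}}

/-- Composition with a holomorphic map. -/
def analyticSubring.comp {V W : Type} [NormedAddCommGroup V] [NormedSpace ℂ V]
    [NormedAddCommGroup W] [NormedSpace ℂ W] {θ : W → V} {p : W} (hθ : AnalyticAt ℂ θ p) :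
    analyticSubring (θ p) →+* analyticSubring p where
  toFun F := ⟨fun w => F.1 (θ w), AnalyticAt.fun_comp F.2 hθ⟩
  map_one' := rfl
  map_mul' _ _ := rfl
  map_zero' := rfl
  map_add' _ _ := rfl

namespace LocalModel

variable (c : X.Model) {J : Type} [Fintype J]

/-- Pullback of germs of functions along the projection from `X × ℂ^J` to `X`. -/
noncomputable def toProdStalk (y : c.U) (z : J → ℂ) : X.Stalk y.1 →+* c.ProdStalk y z :=
  RingHom.liftOfSurjective ((c.pull y).comp (analyticSubring.toHolGerm (c.φ y)))
    (fun t => by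
      obtain ⟨g, rfl⟩ := c.surjective_pull y t
      obtain ⟨F, hF, rfl⟩ := HolGerm.exists_mk g
      exact ⟨⟨F, hF⟩, rfl⟩)
    ⟨(Ideal.Quotient.mk (c.prodIdeal y z)).comp ((analyticSubring.toHolGerm (c.φ y, z)).comp
      (analyticSubring.comp (θ := Prod.fst) (p := (c.φ y, z)) analyticAt_fst)), by
      intro F hF
      have h1 : c.pull y (HolGerm.mk F.1 F.2) =
          c.pull y (HolGerm.mk (fun _ => 0) analyticAt_const) :=
        hF.trans (map_zero (c.pull y)).symm
      exact (c.mk_eq_mk_prodStalk_iff y z (AnalyticAt.comp_fst (p := (c.φ y, z)) F.2)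
        analyticAt_const).mpr (IdealGerm.comp (θ := Prod.fst) (p' := (c.φ y, z))
          ((c.pull_mk_eq_pull_mk_iff y _ _).mp h1) analyticAt_fst)⟩

theorem toProdStalk_pull (y : c.U) (z : J → ℂ) {F : (Fin c.n → ℂ) → ℂ}
    (hF : AnalyticAt ℂ F (c.φ y)) :
    c.toProdStalk y z (c.pull y (HolGerm.mk F hF)) =
      Ideal.Quotient.mk _ (HolGerm.mk (fun p => F p.1)
        (AnalyticAt.comp_fst (p := (c.φ y, z)) hF)) :=
  RingHom.liftOfRightInverse_comp_apply _ _ _ _ (⟨F, hF⟩ : analyticSubring (c.φ y))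

end LocalModel

namespace HolBundle

variable {E F : HolBundle X} {r m n : ℕ}

open Classical in
/-- The section of `𝒪(n)` on `ℙ(E ⊗ F)` whose value at `ζ` is the `k`-th power of the trace of the
product of the operators attached to `s` and the sections `t j` transported by `ζ`. -/
noncomputable def tensorSection (hr : 0 < r) (s : E.OSection r) (t : Fin m → F.OSection r)
    (q k : ℕ) (hn : r * m * k = n) : (E.tensor F).OSection n where
  val i x hx ζ := wordVal q k (s.coeff (i := i.1) hx.1) (fun j => (t j).coeff (i := i.2) hx.2) ζ
  val_transition i j x hi hj ζ _ := by
    have h1 := tensorG_germ E F i j x (ComplexSpace.mem_inf hi hj)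
    refine (congrArg (fun M => wordVal q k _ _ (ζ ᵥ* M)) h1).trans ?_
    refine (wordVal_vecMul_kronecker q k _ _ ζ _ (E.gAt hj.1 hi.1) _ (E.gAt_mul_gAt hi.1 hj.1)
      (E.gAt_mul_gAt hj.1 hi.1)).trans ?_
    rw [s.coeff_eq_mulVec hr hi.1 hj.1]
    congr 1
    exact funext fun l => ((t l).coeff_eq_mulVec hr hi.2 hj.2).symm
  holo i c := by
    let σ : ∀ (y : c.U) (z : E.J i.1 × F.J i.2 → ℂ), c.ProdStalk y z := fun y z =>
      if hy : y.1 ∈ (E.tensor F).U i then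
        wordVal q k (c.toProdStalk y z ∘ s.coeff (i := i.1) hy.1)
          (fun j => c.toProdStalk y z ∘ (t j).coeff (i := i.2) hy.2)
          fun a => Ideal.Quotient.mk _ (HolGerm.mk (fun p => p.2 a)
            (analyticAt_snd_apply a))
      else 0
    refine ⟨σ, fun x v hx _ => ?_⟩
    obtain ⟨A, hA, hsA⟩ := s.exists_eventually_coeff_eq hr (i := i.1) (x := x) hx.1
    choose B hB htB using fun j => (t j).exists_eventually_coeff_eq hr (i := i.2) (x := x) hx.2
    obtain ⟨ε, hε, hball⟩ := c.eventually_of_eventually_φ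
      (hsA.and (Filter.eventually_all.mpr htB))
    obtain ⟨ε', hε', hball'⟩ := Metric.eventually_nhds_iff_ball.mp
      ((Filter.eventually_all.mpr fun α => (hA α).eventually_analyticAt).and
        (Filter.eventually_all.mpr fun j => Filter.eventually_all.mpr fun α =>
          (hB j α).eventually_analyticAt))
    refine ⟨{
      N := {p | p.1 ∈ Metric.ball (c.φ x) ε ∩ Metric.ball (c.φ x) ε'}
      isOpen_N := (Metric.isOpen_ball.inter Metric.isOpen_ball).preimage continuous_fst
      smul_mem := fun _ _ _ _ h => h
      F := fun p => wordVal q k (fun α => A α p.1) (fun j α => B j α p.1) fun a => p.2 a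
      analytic_F := fun p hp => analyticAt_wordVal q k
        (fun α => ((hball' p.1 hp.2).1 α).comp_fst)
        (fun j α => ((hball' p.1 hp.2).2 j α).comp_fst)
        fun a => analyticAt_snd_apply (J := (E.tensor F).J i) a
      homog := fun w z a _ _ => hn ▸ wordVal_smul q k _ _ _ a },
      ⟨Metric.mem_ball_self hε, Metric.mem_ball_self hε'⟩, ?_, ?_⟩
    · intro y z hN hy _
      obtain ⟨h1, h2⟩ := hball y hN.1
      obtain ⟨h3, h4⟩ := hball' _ hN.2
      rw [map_mk_wordVal (W := (Fin c.n → ℂ) × ((E.tensor F).J i → ℂ)) _ q k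
        (fun α => AnalyticAt.comp_fst (h3 α))
        (fun j α => AnalyticAt.comp_fst (h4 j α))
        fun a => analyticAt_snd_apply (J := (E.tensor F).J i) a]
      simp only [σ, dif_pos hy]
      congr 1
      · rw [h1 h3 hy.1]
        exact funext fun α => c.toProdStalk_pull y z (h3 α)
      · funext j
        rw [h2 j (h4 j) hy.2]
        exact funext fun α => c.toProdStalk_pull y z (h4 j α)
    · intro y hy Z hZ hN _
      obtain ⟨h1, h2⟩ := hball y hN.1
      obtain ⟨h3, h4⟩ := hball' _ hN.2
      rw [h1 h3 hy.1]
      refine Eq.trans ?_ (map_mk_wordVal (c.pull y) q k h3 h4 (analyticAt_pi_iff.mp hZ) _).symm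
      congr 1
      exact funext fun j => h2 j (h4 j) hy.2

/-- Non-vanishing at a point is non-vanishing of the form obtained by evaluating the
coefficients. -/
theorem generatesAt_iff {s : E.OSection r} {i : E.ι} {x : X.Pt} (hx : x ∈ E.U i) (c : X.Model)
    (hc : x ∈ c.U) {v : E.J i → ℂ} (hv : v ≠ 0) :
    s.GeneratesAt i x hx v ↔ tval (c.eval ⟨x, hc⟩ ∘ s.coeff hx) v ≠ 0 := by
  obtain ⟨a, ha⟩ := Function.ne_iff.mp hv
  rw [OSection.GeneratesAt, (s.isCoeff_coeff hx).2 _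
    ⟨a, (IsUnit.mk0 _ ha).map (X.constGermHom x)⟩, c.isUnit_iff_eval_ne_zero ⟨x, hc⟩, map_tval]
  have h1 : (c.eval ⟨x, hc⟩ ∘ fun a => X.constGerm x (v a)) = v :=
    funext fun a => c.eval_constGerm ⟨x, hc⟩ (v a)
  rw [h1]

end HolBundle

end CplxGeom

theorem mainTheorem4 (r e : ℕ) (hr : 0 < r) :
    ∃ n : ℕ, 0 < n ∧
      ∀ (X : CplxGeom.ComplexSpace.{u}) (E F : CplxGeom.HolBundle X),
        E.HasRank e → E.OIsGBS r → F.OIsGBS r → (E.tensor F).OIsGBS (n * r) := by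
  obtain ⟨n, hn, H⟩ := TensorWord.exists_uniform_length.{u, u} r e
  refine ⟨n, hn, fun X E F hE hEr hFr ⟨i, j⟩ x hx v hv => ?_⟩
  change E.J i × F.J j → ℂ at v
  obtain ⟨c, hc⟩ := X.exists_model x
  let ev := c.eval ⟨x, hc⟩
  obtain ⟨s, q, l, -, ⟨k, rfl⟩, hne⟩ := H
    (fun s : E.OSection r => ev ∘ s.coeff (i := i) hx.1)
    (fun t : F.OSection r => ev ∘ t.coeff (i := j) hx.2)
    (Matrix.of fun a b => v (a, b)) (hE i x hx.1)
    (fun h => hv (funext fun p => congrFun (congrFun h p.1) p.2))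
    (fun z hz => (hEr i x hx.1 z hz).imp fun s hs =>
      (CplxGeom.HolBundle.generatesAt_iff _ c hc hz).mp hs)
    (fun z hz => (hFr j x hx.2 z hz).imp fun s hs =>
      (CplxGeom.HolBundle.generatesAt_iff _ c hc hz).mp hs)
  refine ⟨CplxGeom.HolBundle.tensorSection hr s l.get q k (by ring), ?_⟩
  refine (c.isUnit_iff_eval_ne_zero ⟨x, hc⟩ _).mpr ?_
  have h1 := TensorWord.map_wordVal ev q k (s.coeff (i := i) hx.1)
    (fun a => (l.get a).coeff (i := j) hx.2) fun a => X.constGerm x (v a)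
  refine h1.trans_ne ?_
  have h2 : (ev ∘ fun a => X.constGerm x (v a)) = v :=
    funext fun a => c.eval_constGerm ⟨x, hc⟩ (v a)
  rw [h2, TensorWord.wordVal]
  refine pow_ne_zero k ?_
  rw [← List.ofFn_get l, List.map_ofFn] at hne
  exact hne
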